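/- Let $D$ be a Hopf algebra over a field $k$, with comultiplication $d\mapsto d_1\otimes d_2$, and let $\mathcal C={}^D_D\mathcal{YD}$ be the category of left Yetter–Drinfeld modules over $D$: left $D$-modules and left $D$-comodules with $d_1v_{(-1)}\otimes d_2\cdot v_{(0)}=(d_1\cdot v)_{(-1)}d_2\otimes(d_1\cdot v)_{(0)}$ for all $d,v$; morphisms are the $D$-linear and $D$-colinear maps, the tensor product carries the diagonal action and the codiagonal coaction, the unit object is $I=k$, and the braiding is $C(x\otimes y)=x_{(-1)}\cdot y\otimes x_{(0)}$. All objects and morphisms below are in $\mathcal C$, and $X$ also denotes $\mathrm{id}_X$. **(a)** $\mathcal C$ has equalisers and coequalisers. For $f,g:X\to Y$, a morphism $e$ with $fe=ge$ is an equaliser of $f,g$ if and only if it is injective with image $\ker(f-g)$; a morphism $q$ with $qf=qg$ is a coequaliser of $f,g$ if and only if it is surjective with kernel $\mathrm{Im}(f-g)$. **(b)** Let $H$ be a Hopf algebra in $\mathcal C$ (a braided Hopf algebra), and let $A$ and $B$ be algebras in $\mathcal C$. The following are equivalent. (i) There are a weak action $\alpha:H\otimes B\to B$ and a convolution invertible 2-cocycle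 $\sigma:H\otimes H\to B$ such that $A\cong B\#_\sigma H$ as algebras in $\mathcal C$ (so that $B\#_\sigma H$ is an associative and unital algebra). (ii) There are $\psi:A\to A\otimes H$ and an algebra morphism $p:B\to A$ such that $(A,\psi)$ is a right $H$-comodule algebra with coinvariants $B=A^{coH}$, that is, $p$ is an equaliser of $\psi$ and $A\otimes\eta_H$; the extension $A/B$ is Galois; the canonical epimorphism $q:A\otimes A\to A\otimes_BA$ splits in $\mathcal C$; and $A\cong B\otimes H$ in $\mathcal C$ as left $B$-modules and right $H$-comodules. Moreover, for any given $\psi:A\to A\otimes H$ and $p:B\to A$, the conditions in (ii) hold for $(\psi,p)$ if and only if $\alpha,\sigma$ and the algebra isomorphism $B\#_\sigma H\cong A$ in (i) can be chosen so that the isomorphism carries $B\otimes\Delta_H$ to $\psi$ and $B\otimes\eta_H$ to $p$. Here: - $\alpha$ is a *weak action* if $\alpha(H\otimes m_B)=m_B(\alpha\otimes\alpha)(H\otimes C\otimes B)(\Delta_H\otimes B\otimes B)$ and $\alpha(H\otimes\eta_B)=\eta_B\epsilon_H$. - $\sigma$ is a *2-cocycle* if $\sigma(H\otimes\eta_H)=\sigma(\eta_H\otimes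 H)=\eta_B\epsilon_H$ and $m_B(\alpha\otimes\sigma)(H\otimes C\otimes H)(H\otimes H\otimes\sigma\otimes m_H)(H\otimes H\otimes H\otimes C\otimes H)(\Delta_H\otimes\Delta_H\otimes\Delta_H)=m_B(B\otimes\sigma)(\sigma\otimes m_H\otimes H)(H\otimes C\otimes H\otimes H)(\Delta_H\otimes\Delta_H\otimes H)$. It is *convolution invertible* if it is invertible in the monoid of morphisms $H\otimes H\to B$, where $H\otimes H$ has the comultiplication $(H\otimes C\otimes H)(\Delta_H\otimes\Delta_H)$. - $B\#_\sigma H$ is $B\otimes H$ with unit $\eta_B\otimes\eta_H$ and multiplication $(m_B\otimes H)(m_B\otimes\sigma\otimes m_H)(B\otimes B\otimes H\otimes C\otimes H)(B\otimes\alpha\otimes\Delta_H\otimes\Delta_H)(B\otimes H\otimes C\otimes H)(B\otimes\Delta_H\otimes B\otimes H)$. - $(A,\psi)$ is a *right $H$-comodule algebra* if $\psi$ is a coassociative and counital coaction and a morphism of algebras, where $A\otimes H$ has the multiplication $(m_A\otimes m_H)(A\otimes C\otimes H)$. - $q:A\otimes A\to A\otimes_BA$ is the coequaliser of $(m_A\otimes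 A)(A\otimes p\otimes A)$ and $(A\otimes m_A)(A\otimes p\otimes A)$. The extension $A/B$ is *Galois* if there is an isomorphism $can:A\otimes_BA\to A\otimes H$ with $can\circ q=(m_A\otimes H)(A\otimes\psi)$. - On $B\otimes H$, the $B$-action is $m_B\otimes H$ and the $H$-coaction is $B\otimes\Delta_H$; $B$ acts on $A$ by $m_A(p\otimes A)$. -/

import Mathlib

universe u

open TensorProduct

set_option linter.unusedVariables false

noncomputable section

namespace YetterDrinfeld

section Sweedler

variable {k D V W : Type u} [Field k] [Ring D] [HopfAlgebra k D]
  [AddCommGroup V] [Module k V] [AddCommGroup W] [Module k W]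

/-- The diagonal action `d · (v ⊗ w) = d₁ · v ⊗ d₂ · w` of `D` on a tensor product of two
representations of `D`. -/
def tensorAct (f : D →ₐ[k] Module.End k V) (g : D →ₐ[k] Module.End k W) :
    D →ₐ[k] Module.End k (V ⊗[k] W) :=
  (Module.endTensorEndAlgHom (R := k) (S := k) (A := k) (M := V) (N := W)).comp
    ((Algebra.TensorProduct.map f g).comp (Bialgebra.comulAlgHom k D))

/-- The bilinear map `(x ⊗ v, y ⊗ w) ↦ x y ⊗ (v ⊗ w)`. -/
def mulTensor : (D ⊗[k] V) ⊗[k] (D ⊗[k] W) →ₗ[k] D ⊗[k] (V ⊗[k] W) :=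
  (LinearMap.mul' k D).rTensor (V ⊗[k] W) ∘ₗ
    (TensorProduct.tensorTensorTensorComm k D V D W).toLinearMap

/-- The codiagonal coaction `v ⊗ w ↦ v₍₋₁₎ w₍₋₁₎ ⊗ (v₍₀₎ ⊗ w₍₀₎)` of `D` on a tensor product. -/
def tensorCoact (ρ : V →ₗ[k] D ⊗[k] V) (σ : W →ₗ[k] D ⊗[k] W) :
    V ⊗[k] W →ₗ[k] D ⊗[k] (V ⊗[k] W) :=
  mulTensor ∘ₗ TensorProduct.map ρ σ

/-- The bilinear map `(a, b) ↦ (a · v)₍₋₁₎ b ⊗ (a · v)₍₀₎`. -/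
def coactActMul (f : D →ₐ[k] Module.End k V) (ρ : V →ₗ[k] D ⊗[k] V) (v : V) :
    D →ₗ[k] D →ₗ[k] D ⊗[k] V :=
  LinearMap.mk₂ k (fun a b => ((LinearMap.mul k D).flip b).rTensor V (ρ (f a v)))
    (by intros; simp) (by intros; simp)
    (by intros; rw [map_add, LinearMap.rTensor_add]; rfl)
    (by intros; rw [map_smul, LinearMap.rTensor_smul]; rfl)

/-- `ρ : V → D ⊗ V` is a left coaction of `D` on `V`: it is coassociative and counital. -/
structure IsCoaction (ρ : V →ₗ[k] D ⊗[k] V) : Prop where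
  coassoc : ∀ v, TensorProduct.assoc k D D V (Coalgebra.comul.rTensor V (ρ v)) =
    ρ.lTensor D (ρ v)
  counit : ∀ v, TensorProduct.lid k V (Coalgebra.counit.rTensor V (ρ v)) = v

/-- The Yetter–Drinfeld condition
`d₁ v₍₋₁₎ ⊗ d₂ · v₍₀₎ = (d₁ · v)₍₋₁₎ d₂ ⊗ (d₁ · v)₍₀₎` for all `d` and `v`; as `D` has an antipode
`S`, it is equivalent to `(d · v)₍₋₁₎ ⊗ (d · v)₍₀₎ = d₁ v₍₋₁₎ S(d₃) ⊗ d₂ · v₍₀₎`. -/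
def Compatible (f : D →ₐ[k] Module.End k V) (ρ : V →ₗ[k] D ⊗[k] V) : Prop :=
  ∀ (d : D) (v : V), tensorAct (Algebra.lmul k D) f d (ρ v) =
    TensorProduct.lift (coactActMul f ρ v) (Coalgebra.comul (R := k) d)


theorem tensorAct_apply (f : D →ₐ[k] Module.End k V) (g : D →ₐ[k] Module.End k W) (d : D) :
    tensorAct f g d = TensorProduct.homTensorHomMap (.id k) V W V W
      (TensorProduct.map f.toLinearMap g.toLinearMap (Coalgebra.comul (R := k) d)) := rfl

theorem tensorAct_eq_sum (f : D →ₐ[k] Module.End k V) (g : D →ₐ[k] Module.End k W) (d : D)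
    {ι : Type*} (r : Coalgebra.Repr k d ι) :
    tensorAct f g d = ∑ i ∈ r.index, TensorProduct.map (f (r.left i)) (g (r.right i)) := by
  rw [tensorAct_apply, ← r.eq]
  simp

@[simp]
theorem mulTensor_tmul (a b : D) (v : V) (w : W) :
    mulTensor ((a ⊗ₜ[k] v) ⊗ₜ[k] (b ⊗ₜ[k] w)) = (a * b) ⊗ₜ[k] (v ⊗ₜ[k] w) := by
  simp [mulTensor]

@[simp]
theorem tensorCoact_tmul (ρ : V →ₗ[k] D ⊗[k] V) (σ : W →ₗ[k] D ⊗[k] W) (v : V) (w : W) :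
    tensorCoact ρ σ (v ⊗ₜ[k] w) = mulTensor (ρ v ⊗ₜ[k] σ w) := rfl

@[simp]
theorem coactActMul_apply (f : D →ₐ[k] Module.End k V) (ρ : V →ₗ[k] D ⊗[k] V) (v : V) (a b : D) :
    coactActMul f ρ v a b = ((LinearMap.mul k D).flip b).rTensor V (ρ (f a v)) := rfl

theorem sum_coassoc {M : Type*} [AddCommGroup M] [Module k M] (T : D ⊗[k] (D ⊗[k] D) →ₗ[k] M)
    (d : D) {ι : Type*} {κ μ : ι → Type*} (r : Coalgebra.Repr k d ι)
    (s : (i : ι) → Coalgebra.Repr k (r.left i) (κ i))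
    (t : (i : ι) → Coalgebra.Repr k (r.right i) (μ i)) :
    ∑ i ∈ r.index, ∑ j ∈ (s i).index,
        T ((s i).left j ⊗ₜ ((s i).right j ⊗ₜ r.right i)) =
      ∑ i ∈ r.index, ∑ j ∈ (t i).index,
        T (r.left i ⊗ₜ ((t i).left j ⊗ₜ (t i).right j)) := by
  simpa using congrArg T (Coalgebra.sum_tmul_tmul_eq r s t)

theorem Compatible.sum {f : D →ₐ[k] Module.End k V} {ρ : V →ₗ[k] D ⊗[k] V} (h : Compatible f ρ)
    (d : D) (v : V) {ι : Type*} (r : Coalgebra.Repr k d ι) :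
    ∑ i ∈ r.index,
        TensorProduct.map (LinearMap.mul k D (r.left i)) (f (r.right i)) (ρ v) =
      ∑ i ∈ r.index, ((LinearMap.mul k D).flip (r.right i)).rTensor V (ρ (f (r.left i) v)) := by
  have := h d v
  rw [tensorAct_eq_sum _ _ _ r, ← r.eq] at this
  simpa using this

theorem compatible_of_sum {f : D →ₐ[k] Module.End k V} {ρ : V →ₗ[k] D ⊗[k] V}
    (h : ∀ (d : D) (v : V), ∃ (ι : Type u) (r : Coalgebra.Repr k d ι),
    ∑ i ∈ r.index,
        TensorProduct.map (LinearMap.mul k D (r.left i)) (f (r.right i)) (ρ v) =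
      ∑ i ∈ r.index, ((LinearMap.mul k D).flip (r.right i)).rTensor V (ρ (f (r.left i) v))) :
    Compatible f ρ := by
  intro d v
  obtain ⟨ι, r, hr⟩ := h d v
  rw [tensorAct_eq_sum _ _ _ r, ← r.eq]
  simpa using hr


theorem mulTensor_balanced (b : D) (x : D ⊗[k] V) (y : D ⊗[k] W) :
    mulTensor (((LinearMap.mul k D).flip b).rTensor V x ⊗ₜ[k] y) =
      mulTensor (x ⊗ₜ[k] (LinearMap.mul k D b).rTensor W y) := by
  induction x with
  | zero => simp
  | add x x' hx hx' => simp [TensorProduct.add_tmul, hx, hx']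
  | tmul p v =>
    induction y with
    | zero => simp
    | add y y' hy hy' => simp only [TensorProduct.tmul_add, map_add, hy, hy']
    | tmul q w => simp [mul_assoc]

theorem mulTensor_mul_right (b : D) (x : D ⊗[k] V) (y : D ⊗[k] W) :
    mulTensor (x ⊗ₜ[k] ((LinearMap.mul k D).flip b).rTensor W y) =
      ((LinearMap.mul k D).flip b).rTensor (V ⊗[k] W) (mulTensor (x ⊗ₜ[k] y)) := by
  induction x with
  | zero => simp
  | add x x' hx hx' => simp only [TensorProduct.add_tmul, map_add, hx, hx']
  | tmul p v =>
    induction y with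
    | zero => simp
    | add y y' hy hy' => simp only [TensorProduct.tmul_add, map_add, hy, hy']
    | tmul q w => simp [mul_assoc]

theorem mulTensor_map (a : D) (φ : Module.End k V) (χ : Module.End k W)
    (x : D ⊗[k] V) (y : D ⊗[k] W) :
    TensorProduct.map (LinearMap.mul k D a) (TensorProduct.map φ χ) (mulTensor (x ⊗ₜ[k] y)) =
      mulTensor (TensorProduct.map (LinearMap.mul k D a) φ x ⊗ₜ[k] χ.lTensor D y) := by
  induction x with
  | zero => simp
  | add x x' hx hx' => simp only [TensorProduct.add_tmul, map_add, hx, hx']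
  | tmul p v =>
    induction y with
    | zero => simp
    | add y y' hy hy' => simp only [TensorProduct.tmul_add, map_add, hy, hy']
    | tmul q w => simp [mul_assoc]

open Coalgebra in
theorem Compatible.tensor {f : D →ₐ[k] Module.End k V} {ρ : V →ₗ[k] D ⊗[k] V}
    {g : D →ₐ[k] Module.End k W} {σ : W →ₗ[k] D ⊗[k] W}
    (h : Compatible f ρ) (h' : Compatible g σ) :
    Compatible (tensorAct f g) (tensorCoact ρ σ) := by
  intro d z
  induction z with
  | zero =>
    rw [map_zero, map_zero, show coactActMul (tensorAct f g) (tensorCoact ρ σ) 0 = 0 by ext; simp,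
      show TensorProduct.lift (0 : D →ₗ[k] D →ₗ[k] D ⊗[k] (V ⊗[k] W)) = 0 from
        TensorProduct.ext' (by simp), LinearMap.zero_apply]
  | add z z' hz hz' =>
    rw [map_add, map_add, hz, hz', ← LinearMap.add_apply]
    refine LinearMap.congr_fun (TensorProduct.ext' fun a b => ?_) _
    simp
  | tmul v w =>
    let r := ℛ k d
    let s := fun i => ℛ k (r.left i)
    let t := fun i => ℛ k (r.right i)
    let evx : Module.End k (D ⊗[k] V) →ₗ[k] D ⊗[k] V := LinearMap.applyₗ (ρ v)
    let evy : Module.End k (D ⊗[k] W) →ₗ[k] D ⊗[k] W := LinearMap.applyₗ (σ w)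
    let F : D ⊗[k] (D ⊗[k] D) →ₗ[k] D ⊗[k] (V ⊗[k] W) :=
      mulTensor ∘ₗ TensorProduct.map
        (evx ∘ₗ TensorProduct.homTensorHomMap (.id k) D V D V ∘ₗ
          TensorProduct.map (LinearMap.mul k D) f.toLinearMap)
        (evy ∘ₗ LinearMap.lTensorHom D ∘ₗ g.toLinearMap) ∘ₗ
        (TensorProduct.assoc k D D D).symm.toLinearMap
    have hF (a b c) : F (a ⊗ₜ (b ⊗ₜ c)) = mulTensor
        (TensorProduct.map (LinearMap.mul k D a) (f b) (ρ v) ⊗ₜ (g c).lTensor D (σ w)) := by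
      simp [F, evx, evy]
    let G : D ⊗[k] (D ⊗[k] D) →ₗ[k] D ⊗[k] (V ⊗[k] W) :=
      mulTensor ∘ₗ TensorProduct.map (ρ ∘ₗ f.toLinearMap.flip v)
        (evy ∘ₗ TensorProduct.homTensorHomMap (.id k) D W D W ∘ₗ
          TensorProduct.map (LinearMap.mul k D) g.toLinearMap)
    have hG (a b c) : G (a ⊗ₜ (b ⊗ₜ c)) = mulTensor
        (ρ (f a v) ⊗ₜ TensorProduct.map (LinearMap.mul k D b) (g c) (σ w)) := by
      simp [G, evy]
    let K : D ⊗[k] (D ⊗[k] D) →ₗ[k] D ⊗[k] (V ⊗[k] W) :=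
      TensorProduct.lift (LinearMap.rTensorHom (V ⊗[k] W) ∘ₗ (LinearMap.mul k D).flip).flip ∘ₗ
      TensorProduct.map (mulTensor ∘ₗ TensorProduct.map (ρ ∘ₗ f.toLinearMap.flip v)
        (σ ∘ₗ g.toLinearMap.flip w)) LinearMap.id ∘ₗ
        (TensorProduct.assoc k D D D).symm.toLinearMap
    have hK (a b c) : K (a ⊗ₜ (b ⊗ₜ c)) = ((LinearMap.mul k D).flip c).rTensor (V ⊗[k] W)
        (mulTensor (ρ (f a v) ⊗ₜ σ (g b w))) := by
      simp [K]
    have e1 : tensorAct (Algebra.lmul k D) (tensorAct f g) d (tensorCoact ρ σ (v ⊗ₜ w)) =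
        ∑ i ∈ r.index, ∑ j ∈ (t i).index, F (r.left i ⊗ₜ ((t i).left j ⊗ₜ (t i).right j)) := by
      rw [tensorAct_eq_sum _ _ _ r, LinearMap.sum_apply]
      refine Finset.sum_congr rfl fun i _ => ?_
      rw [tensorAct_eq_sum _ _ _ (t i), tensorCoact_tmul]
      rw [← TensorProduct.homTensorHomMap_apply, TensorProduct.tmul_sum, map_sum,
        LinearMap.sum_apply]
      refine Finset.sum_congr rfl fun j _ => ?_
      rw [hF, ← mulTensor_map]
      rfl
    have e2 : ∑ i ∈ r.index, ∑ j ∈ (s i).index, F ((s i).left j ⊗ₜ ((s i).right j ⊗ₜ r.right i)) =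
        ∑ i ∈ r.index, ∑ j ∈ (s i).index,
          G ((s i).left j ⊗ₜ ((s i).right j ⊗ₜ r.right i)) := by
      refine Finset.sum_congr rfl fun i _ => ?_
      simp only [hF, hG]
      rw [← map_sum, ← TensorProduct.sum_tmul, h.sum (r.left i) v (s i), TensorProduct.sum_tmul,
        map_sum]
      refine Finset.sum_congr rfl fun j _ => ?_
      rw [mulTensor_balanced]
      congr 2
      rw [← LinearMap.comp_apply, LinearMap.rTensor_comp_lTensor]
    have e3 : ∑ i ∈ r.index, ∑ j ∈ (t i).index, G (r.left i ⊗ₜ ((t i).left j ⊗ₜ (t i).right j)) =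
        ∑ i ∈ r.index, ∑ j ∈ (t i).index, K (r.left i ⊗ₜ ((t i).left j ⊗ₜ (t i).right j)) := by
      refine Finset.sum_congr rfl fun i _ => ?_
      simp only [hG, hK]
      rw [← map_sum, ← TensorProduct.tmul_sum, h'.sum (r.right i) w (t i), TensorProduct.tmul_sum,
        map_sum]
      refine Finset.sum_congr rfl fun j _ => ?_
      rw [mulTensor_mul_right]
    have e4 : ∑ i ∈ r.index, ∑ j ∈ (s i).index, K ((s i).left j ⊗ₜ ((s i).right j ⊗ₜ r.right i)) =
        TensorProduct.lift (coactActMul (tensorAct f g) (tensorCoact ρ σ) (v ⊗ₜ w))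
          (Coalgebra.comul (R := k) d) := by
      rw [← r.eq, map_sum]
      refine Finset.sum_congr rfl fun i _ => ?_
      simp only [hK]
      rw [TensorProduct.lift.tmul, coactActMul_apply, tensorAct_eq_sum _ _ _ (s i),
        LinearMap.sum_apply, map_sum, map_sum]
      rfl
    rw [e1, ← sum_coassoc F d r s t, e2, sum_coassoc G d r s t, e3, ← sum_coassoc K d r s t, e4]


theorem tensorCoact_coassoc {ρ : V →ₗ[k] D ⊗[k] V} {σ : W →ₗ[k] D ⊗[k] W}
    (h : ∀ v, TensorProduct.assoc k D D V (Coalgebra.comul.rTensor V (ρ v)) = ρ.lTensor D (ρ v))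
    (h' : ∀ w, TensorProduct.assoc k D D W (Coalgebra.comul.rTensor W (σ w)) = σ.lTensor D (σ w))
    (z : V ⊗[k] W) :
    TensorProduct.assoc k D D (V ⊗[k] W)
        (Coalgebra.comul.rTensor (V ⊗[k] W) (tensorCoact ρ σ z)) =
      (tensorCoact ρ σ).lTensor D (tensorCoact ρ σ z) := by
  let P : (D ⊗[k] (D ⊗[k] V)) ⊗[k] (D ⊗[k] (D ⊗[k] W)) →ₗ[k] D ⊗[k] (D ⊗[k] (V ⊗[k] W)) :=
    mulTensor.lTensor D ∘ₗ mulTensor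
  have h1 (x : D ⊗[k] V) (y : D ⊗[k] W) :
      TensorProduct.assoc k D D (V ⊗[k] W)
        (Coalgebra.comul.rTensor (V ⊗[k] W) (mulTensor (x ⊗ₜ y))) =
      P (TensorProduct.assoc k D D V (Coalgebra.comul.rTensor V x) ⊗ₜ
        TensorProduct.assoc k D D W (Coalgebra.comul.rTensor W y)) := by
    induction x with
    | zero => simp
    | add x x' hx hx' => simp only [TensorProduct.add_tmul, map_add, hx, hx']
    | tmul p v =>
      induction y with
      | zero => simp
      | add y y' hy hy' => simp only [TensorProduct.tmul_add, map_add, hy, hy']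
      | tmul q w =>
        rw [mulTensor_tmul, LinearMap.rTensor_tmul, LinearMap.rTensor_tmul, LinearMap.rTensor_tmul,
          Bialgebra.comul_mul]
        generalize Coalgebra.comul (R := k) p = p'
        generalize Coalgebra.comul (R := k) q = q'
        induction p' with
        | zero => simp
        | add x x' hx hx' => simp only [TensorProduct.add_tmul, map_add, add_mul, hx, hx']
        | tmul a b =>
          induction q' with
          | zero => simp
          | add x x' hx hx' =>
            simp only [TensorProduct.add_tmul, TensorProduct.tmul_add, map_add, mul_add, hx, hx']
          | tmul c d => simp [P]
  have h2 (x : D ⊗[k] V) (y : D ⊗[k] W) :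
      (tensorCoact ρ σ).lTensor D (mulTensor (x ⊗ₜ y)) = P (ρ.lTensor D x ⊗ₜ σ.lTensor D y) := by
    induction x with
    | zero => simp
    | add x x' hx hx' => simp only [TensorProduct.add_tmul, map_add, hx, hx']
    | tmul p v =>
      induction y with
      | zero => simp
      | add y y' hy hy' => simp only [TensorProduct.tmul_add, map_add, hy, hy']
      | tmul q w => simp [P]
  induction z with
  | zero => simp
  | add z z' hz hz' => simp only [map_add, hz, hz']
  | tmul v w => rw [tensorCoact_tmul, h1, h2, h, h']

theorem tensorCoact_counit {ρ : V →ₗ[k] D ⊗[k] V} {σ : W →ₗ[k] D ⊗[k] W}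
    (h : ∀ v, TensorProduct.lid k V (Coalgebra.counit.rTensor V (ρ v)) = v)
    (h' : ∀ w, TensorProduct.lid k W (Coalgebra.counit.rTensor W (σ w)) = w) (z : V ⊗[k] W) :
    TensorProduct.lid k (V ⊗[k] W) (Coalgebra.counit.rTensor (V ⊗[k] W) (tensorCoact ρ σ z)) =
      z := by
  have h1 (x : D ⊗[k] V) (y : D ⊗[k] W) :
      TensorProduct.lid k (V ⊗[k] W) (Coalgebra.counit.rTensor (V ⊗[k] W) (mulTensor (x ⊗ₜ y))) =
      TensorProduct.lid k V (Coalgebra.counit.rTensor V x) ⊗ₜ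
        TensorProduct.lid k W (Coalgebra.counit.rTensor W y) := by
    induction x with
    | zero => simp
    | add x x' hx hx' => simp only [TensorProduct.add_tmul, map_add, hx, hx']
    | tmul p v =>
      induction y with
      | zero => simp
      | add y y' hy hy' => simp only [TensorProduct.tmul_add, map_add, hy, hy']
      | tmul q w =>
        simp only [mulTensor_tmul, LinearMap.rTensor_tmul, TensorProduct.lid_tmul,
          Bialgebra.counit_mul, TensorProduct.smul_tmul_smul]
  induction z with
  | zero => simp
  | add z z' hz hz' => simp only [map_add, hz, hz']
  | tmul v w => rw [tensorCoact_tmul, h1, h, h']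

section

variable {U V' W' : Type u} [AddCommGroup U] [Module k U] [AddCommGroup V'] [Module k V']
  [AddCommGroup W'] [Module k W']

open Coalgebra in
theorem map_tensorAct {f : D →ₐ[k] Module.End k V} {f' : D →ₐ[k] Module.End k V'}
    {g : D →ₐ[k] Module.End k W} {g' : D →ₐ[k] Module.End k W'}
    (φ : V →ₗ[k] V') (χ : W →ₗ[k] W') (h : ∀ d v, φ (f d v) = f' d (φ v))
    (h' : ∀ d w, χ (g d w) = g' d (χ w)) (d : D) (z : V ⊗[k] W) :
    TensorProduct.map φ χ (tensorAct f g d z) = tensorAct f' g' d (TensorProduct.map φ χ z) := by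
  let r := ℛ k d
  rw [tensorAct_eq_sum f g d r, tensorAct_eq_sum f' g' d r]
  induction z with
  | zero => simp
  | add z z' hz hz' => simp only [map_add, hz, hz']
  | tmul v w => simp [h, h']

theorem map_mulTensor (φ : V →ₗ[k] V') (χ : W →ₗ[k] W') (x : D ⊗[k] V) (y : D ⊗[k] W) :
    (TensorProduct.map φ χ).lTensor D (mulTensor (x ⊗ₜ y)) =
      mulTensor (φ.lTensor D x ⊗ₜ χ.lTensor D y) := by
  induction x with
  | zero => simp
  | add x x' hx hx' => simp only [TensorProduct.add_tmul, map_add, hx, hx']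
  | tmul p v =>
    induction y with
    | zero => simp
    | add y y' hy hy' => simp only [TensorProduct.tmul_add, map_add, hy, hy']
    | tmul q w => simp

theorem map_tensorCoact {ρ : V →ₗ[k] D ⊗[k] V} {ρ' : V' →ₗ[k] D ⊗[k] V'}
    {σ : W →ₗ[k] D ⊗[k] W} {σ' : W' →ₗ[k] D ⊗[k] W'}
    (φ : V →ₗ[k] V') (χ : W →ₗ[k] W') (h : ∀ v, ρ' (φ v) = φ.lTensor D (ρ v))
    (h' : ∀ w, σ' (χ w) = χ.lTensor D (σ w)) (z : V ⊗[k] W) :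
    tensorCoact ρ' σ' (TensorProduct.map φ χ z) =
      (TensorProduct.map φ χ).lTensor D (tensorCoact ρ σ z) := by
  induction z with
  | zero => simp
  | add z z' hz hz' => simp only [map_add, hz, hz']
  | tmul v w => rw [TensorProduct.map_tmul, tensorCoact_tmul, tensorCoact_tmul, h, h',
      map_mulTensor]

open Coalgebra in
theorem assoc_tensorAct (e : D →ₐ[k] Module.End k U) (f : D →ₐ[k] Module.End k V)
    (g : D →ₐ[k] Module.End k W) (d : D) (z : (U ⊗[k] V) ⊗[k] W) :
    TensorProduct.assoc k U V W (tensorAct (tensorAct e f) g d z) =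
      tensorAct e (tensorAct f g) d (TensorProduct.assoc k U V W z) := by
  let r := ℛ k d
  let s := fun i => ℛ k (r.left i)
  let t := fun i => ℛ k (r.right i)
  induction z with
  | zero => simp
  | add z z' hz hz' => simp only [map_add, hz, hz']
  | tmul z w =>
    induction z with
    | zero => simp
    | add z z' hz hz' => simp only [map_add, TensorProduct.add_tmul, hz, hz']
    | tmul u v =>
      have := sum_coassoc (TensorProduct.map (e.toLinearMap.flip u)
        (TensorProduct.map (f.toLinearMap.flip v) (g.toLinearMap.flip w))) d r s t
      rw [tensorAct_eq_sum _ _ d r, tensorAct_eq_sum _ _ d r, LinearMap.sum_apply, map_sum,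
        TensorProduct.assoc_tmul, LinearMap.sum_apply]
      simp only [TensorProduct.map_tmul]
      simp only [tensorAct_eq_sum e f _ (s _), tensorAct_eq_sum f g _ (t _), LinearMap.sum_apply,
        TensorProduct.sum_tmul, TensorProduct.tmul_sum, map_sum]
      simpa using this

theorem assoc_tensorCoact (ρ : U →ₗ[k] D ⊗[k] U) (σ : V →ₗ[k] D ⊗[k] V) (τ : W →ₗ[k] D ⊗[k] W)
    (z : (U ⊗[k] V) ⊗[k] W) :
    tensorCoact ρ (tensorCoact σ τ) (TensorProduct.assoc k U V W z) =
      (TensorProduct.assoc k U V W).toLinearMap.lTensor D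
        (tensorCoact (tensorCoact ρ σ) τ z) := by
  induction z with
  | zero => simp
  | add z z' hz hz' => simp only [map_add, hz, hz']
  | tmul z w =>
    induction z with
    | zero => simp
    | add z z' hz hz' => simp only [map_add, TensorProduct.add_tmul, hz, hz']
    | tmul u v =>
      simp only [TensorProduct.assoc_tmul, tensorCoact_tmul]
      generalize ρ u = x
      generalize σ v = y
      generalize τ w = z
      induction x with
      | zero => simp
      | add x x' hx hx' => simp only [TensorProduct.add_tmul, map_add, hx, hx']
      | tmul a u =>
        induction y with
        | zero => simp
        | add x x' hx hx' =>
          simp only [TensorProduct.add_tmul, TensorProduct.tmul_add, map_add, hx, hx']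
        | tmul b v =>
          induction z with
          | zero => simp
          | add x x' hx hx' => simp only [TensorProduct.tmul_add, map_add, hx, hx']
          | tmul c w => simp [mul_assoc]

end

/-- The trivial action of `D` on `k`, through the counit. -/
def trivialAct : D →ₐ[k] Module.End k k :=
  (Algebra.lmul k k).comp (Bialgebra.counitAlgHom k D)

/-- The trivial coaction `c ↦ 1 ⊗ c` of `D` on `k`. -/
def trivialCoact : k →ₗ[k] D ⊗[k] k := TensorProduct.mk k D k 1

open Coalgebra in
theorem trivial_compatible : Compatible (k := k) (D := D) trivialAct trivialCoact := by
  intro d c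
  let r := ℛ k d
  rw [tensorAct_eq_sum _ _ _ r, ← r.eq]
  have h1 := congrArg (TensorProduct.map LinearMap.id ((LinearMap.mul k k).flip c))
    (Coalgebra.sum_tmul_counit_eq r)
  have h2 := congrArg (TensorProduct.map LinearMap.id ((LinearMap.mul k k).flip c) ∘ₗ
    (TensorProduct.comm k k D).toLinearMap) (Coalgebra.sum_counit_tmul_eq r)
  simp only [map_sum, TensorProduct.map_tmul, LinearMap.comp_apply, LinearEquiv.coe_coe,
    TensorProduct.comm_tmul] at h1 h2
  simpa [trivialAct, trivialCoact, mul_comm] using h1.trans h2.symm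

open Coalgebra in
theorem lid_tensorAct (f : D →ₐ[k] Module.End k V) (d : D) (z : k ⊗[k] V) :
    TensorProduct.lid k V (tensorAct trivialAct f d z) = f d (TensorProduct.lid k V z) := by
  let r := ℛ k d
  rw [tensorAct_eq_sum _ _ d r]
  induction z with
  | zero => simp
  | add z z' hz hz' => simp only [map_add, hz, hz']
  | tmul c v =>
    have := congrArg (fun a => c • f a v) (Coalgebra.sum_counit_smul r)
    simp only [map_sum, map_smul, LinearMap.sum_apply, LinearMap.smul_apply] at this
    rw [TensorProduct.lid_tmul, map_smul, ← this]
    simp [trivialAct, mul_comm, mul_smul, Finset.smul_sum]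

open Coalgebra in
theorem rid_tensorAct (f : D →ₐ[k] Module.End k V) (d : D) (z : V ⊗[k] k) :
    TensorProduct.rid k V (tensorAct f trivialAct d z) = f d (TensorProduct.rid k V z) := by
  let r := ℛ k d
  rw [tensorAct_eq_sum _ _ d r]
  induction z with
  | zero => simp
  | add z z' hz hz' => simp only [map_add, hz, hz']
  | tmul v c =>
    have := congrArg (fun a => c • f (TensorProduct.rid k D a) v) (Coalgebra.sum_tmul_counit_eq r)
    simp only [map_sum, TensorProduct.rid_tmul, map_smul, LinearMap.sum_apply,
      LinearMap.smul_apply, one_smul] at this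
    rw [TensorProduct.rid_tmul, map_smul, ← this]
    simp [trivialAct, mul_comm, mul_smul, Finset.smul_sum]

theorem lid_tensorCoact (ρ : V →ₗ[k] D ⊗[k] V) (z : k ⊗[k] V) :
    ρ (TensorProduct.lid k V z) =
      (TensorProduct.lid k V).toLinearMap.lTensor D (tensorCoact trivialCoact ρ z) := by
  induction z with
  | zero => simp
  | add z z' hz hz' => simp only [map_add, hz, hz']
  | tmul c v =>
    rw [tensorCoact_tmul, TensorProduct.lid_tmul, map_smul, trivialCoact]
    generalize ρ v = x
    induction x with
    | zero => simp
    | add x x' hx hx' => simp only [TensorProduct.tmul_add, map_add, smul_add, hx, hx']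
    | tmul a v => simp

theorem rid_tensorCoact (ρ : V →ₗ[k] D ⊗[k] V) (z : V ⊗[k] k) :
    ρ (TensorProduct.rid k V z) =
      (TensorProduct.rid k V).toLinearMap.lTensor D (tensorCoact ρ trivialCoact z) := by
  induction z with
  | zero => simp
  | add z z' hz hz' => simp only [map_add, hz, hz']
  | tmul v c =>
    rw [tensorCoact_tmul, TensorProduct.rid_tmul, map_smul, trivialCoact]
    generalize ρ v = x
    induction x with
    | zero => simp
    | add x x' hx hx' => simp only [TensorProduct.add_tmul, map_add, smul_add, hx, hx']
    | tmul a v => simp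

/-- The map `v ⊗ w ↦ v₍₋₁₎ · w ⊗ v₍₀₎`. -/
def braidLin (ρ : V →ₗ[k] D ⊗[k] V) (g : D →ₐ[k] Module.End k W) : V ⊗[k] W →ₗ[k] W ⊗[k] V :=
  TensorProduct.lift (LinearMap.flip (LinearMap.rTensorHom V ∘ₗ g.toLinearMap.flip) ∘ₗ ρ)

@[simp]
theorem braidLin_tmul (ρ : V →ₗ[k] D ⊗[k] V) (g : D →ₐ[k] Module.End k W) (v : V) (w : W) :
    braidLin ρ g (v ⊗ₜ w) = (g.toLinearMap.flip w).rTensor V (ρ v) := rfl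

open Coalgebra in
theorem braidLin_act {f : D →ₐ[k] Module.End k V} {ρ : V →ₗ[k] D ⊗[k] V}
    (g : D →ₐ[k] Module.End k W) (h : Compatible f ρ) (d : D) (z : V ⊗[k] W) :
    braidLin ρ g (tensorAct f g d z) = tensorAct g f d (braidLin ρ g z) := by
  let r := ℛ k d
  rw [tensorAct_eq_sum _ _ d r, tensorAct_eq_sum _ _ d r]
  induction z with
  | zero => simp
  | add z z' hz hz' => simp only [map_add, hz, hz']
  | tmul v w =>
    have h1 (b : D) (x : D ⊗[k] V) : (g.toLinearMap.flip (g b w)).rTensor V x =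
        (g.toLinearMap.flip w).rTensor V (((LinearMap.mul k D).flip b).rTensor V x) := by
      induction x with
      | zero => simp
      | add x x' hx hx' => simp only [map_add, hx, hx']
      | tmul a v => simp
    have h2 (a b : D) (x : D ⊗[k] V) :
        (g.toLinearMap.flip w).rTensor V (TensorProduct.map (LinearMap.mul k D a) (f b) x) =
        TensorProduct.map (g a) (f b) ((g.toLinearMap.flip w).rTensor V x) := by
      induction x with
      | zero => simp
      | add x x' hx hx' => simp only [map_add, hx, hx']
      | tmul a v => simp
    simp only [LinearMap.sum_apply, map_sum, TensorProduct.map_tmul, braidLin_tmul, h1]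
    rw [← map_sum, ← h.sum d v r, map_sum]
    simp only [h2]

open Coalgebra in
theorem braidLin_coact {ρ : V →ₗ[k] D ⊗[k] V} {g : D →ₐ[k] Module.End k W}
    {σ : W →ₗ[k] D ⊗[k] W}
    (hρ : ∀ v, TensorProduct.assoc k D D V (Coalgebra.comul.rTensor V (ρ v)) = ρ.lTensor D (ρ v))
    (h : Compatible g σ) (z : V ⊗[k] W) :
    tensorCoact σ ρ (braidLin ρ g z) = (braidLin ρ g).lTensor D (tensorCoact ρ σ z) := by
  induction z with
  | zero => simp
  | add z z' hz hz' => simp only [map_add, hz, hz']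
  | tmul v w =>
    let L : D ⊗[k] (D ⊗[k] V) →ₗ[k] D ⊗[k] (W ⊗[k] V) :=
      mulTensor ∘ₗ (σ ∘ₗ g.toLinearMap.flip w).rTensor (D ⊗[k] V)
    have hL (x : D ⊗[k] V) : tensorCoact σ ρ ((g.toLinearMap.flip w).rTensor V x) =
        L (ρ.lTensor D x) := by
      induction x with
      | zero => simp
      | add x x' hx hx' => simp only [map_add, hx, hx']
      | tmul a v => simp [L]
    let B : (D ⊗[k] V) ⊗[k] W →ₗ[k] W ⊗[k] V :=
      TensorProduct.lift (LinearMap.flip (LinearMap.rTensorHom V ∘ₗ g.toLinearMap.flip))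
    let M : (D ⊗[k] (D ⊗[k] V)) ⊗[k] (D ⊗[k] W) →ₗ[k] D ⊗[k] (W ⊗[k] V) :=
      B.lTensor D ∘ₗ mulTensor
    have hM (x : D ⊗[k] V) (y : D ⊗[k] W) :
        (braidLin ρ g).lTensor D (mulTensor (x ⊗ₜ y)) = M (ρ.lTensor D x ⊗ₜ y) := by
      induction x with
      | zero => simp
      | add x x' hx hx' => simp only [TensorProduct.add_tmul, map_add, hx, hx']
      | tmul a v =>
        induction y with
        | zero => simp
        | add x x' hx hx' => simp only [TensorProduct.tmul_add, map_add, hx, hx']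
        | tmul b w => simp [M, B]
    let J (v : V) : D ⊗[k] W →ₗ[k] D ⊗[k] (W ⊗[k] V) :=
      ((TensorProduct.mk k W V).flip v).lTensor D
    have hLJ (a b : D) (v : V) (y : D ⊗[k] W) :
        mulTensor (y ⊗ₜ (b ⊗ₜ v)) = J v (((LinearMap.mul k D).flip b).rTensor W y) := by
      induction y with
      | zero => simp
      | add x x' hx hx' => simp only [TensorProduct.add_tmul, map_add, hx, hx']
      | tmul b w => simp [J]
    have hMJ (a b : D) (v : V) (y : D ⊗[k] W) :
        M ((a ⊗ₜ (b ⊗ₜ v)) ⊗ₜ y) = J v (TensorProduct.map (LinearMap.mul k D a) (g b) y) := by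
      induction y with
      | zero => simp
      | add x x' hx hx' => simp only [TensorProduct.tmul_add, map_add, hx, hx']
      | tmul b w => simp [J, M, B]
    have key (x : D ⊗[k] V) : L (TensorProduct.assoc k D D V (Coalgebra.comul.rTensor V x)) =
        M (TensorProduct.assoc k D D V (Coalgebra.comul.rTensor V x) ⊗ₜ σ w) := by
      induction x with
      | zero => simp
      | add x x' hx hx' => simp only [TensorProduct.add_tmul, map_add, hx, hx']
      | tmul a v =>
        let r := ℛ k a
        rw [LinearMap.rTensor_tmul, ← r.eq]
        simp only [TensorProduct.sum_tmul, map_sum, TensorProduct.assoc_tmul, hMJ]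
        rw [← map_sum (J v), h.sum a w r, map_sum]
        refine Finset.sum_congr rfl fun i _ => ?_
        rw [← hLJ (r.left i)]
        rfl
    rw [braidLin_tmul, tensorCoact_tmul, hL, hM, ← hρ, key]

end Sweedler

variable (k D : Type u) [Field k] [Ring D] [HopfAlgebra k D]

/-- A left Yetter–Drinfeld module over the Hopf algebra `D`: a left `D`-module and left
`D`-comodule satisfying the Yetter–Drinfeld condition. -/
structure YD where
  /-- the underlying vector space -/
  carrier : Type u
  [addCommGroup : AddCommGroup carrier]
  [module : Module k carrier]
  /-- the left action of `D` -/
  act : D →ₐ[k] Module.End k carrier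
  /-- the left coaction of `D` -/
  coact : carrier →ₗ[k] D ⊗[k] carrier
  isCoaction : IsCoaction coact
  compatible : Compatible act coact

attribute [instance] YD.addCommGroup YD.module

namespace YD

variable {k D}

/-- Morphisms of Yetter–Drinfeld modules: linear maps that are `D`-linear and `D`-colinear. -/
@[ext]
structure Hom (X Y : YD k D) where
  /-- the underlying linear map -/
  lin : X.carrier →ₗ[k] Y.carrier
  map_act : ∀ d v, lin (X.act d v) = Y.act d (lin v)
  map_coact : ∀ v, Y.coact (lin v) = lin.lTensor D (X.coact v)

open CategoryTheory MonoidalCategory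

instance : Category (YD k D) where
  Hom := Hom
  id X := ⟨LinearMap.id, by simp, by simp⟩
  comp f g := ⟨g.lin ∘ₗ f.lin, by simp [f.map_act, g.map_act],
    by simp [f.map_coact, g.map_coact, LinearMap.lTensor_comp]⟩

@[ext]
theorem hom_ext {X Y : YD k D} {f g : X ⟶ Y} (h : f.lin = g.lin) : f = g := Hom.ext h

@[simp] theorem id_lin (X : YD k D) : Hom.lin (𝟙 X) = LinearMap.id := rfl
@[simp] theorem comp_lin {X Y Z : YD k D} (f : X ⟶ Y) (g : Y ⟶ Z) :
    (f ≫ g).lin = g.lin ∘ₗ f.lin := rfl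

/-- A bijective morphism, given by a linear equivalence, is an isomorphism. -/
def isoMk {X Y : YD k D} (e : X.carrier ≃ₗ[k] Y.carrier) (h : ∀ d v, e (X.act d v) = Y.act d (e v))
    (h' : ∀ v, Y.coact (e v) = e.toLinearMap.lTensor D (X.coact v)) : X ≅ Y where
  hom := ⟨e.toLinearMap, h, h'⟩
  inv := ⟨e.symm.toLinearMap, fun d v => by
      apply e.injective
      simpa using (h d (e.symm v)).symm, fun v => by
      have := h' (e.symm v)
      simp only [LinearEquiv.apply_symm_apply] at this
      change X.coact (e.symm v) = _
      rw [this, ← LinearMap.comp_apply, ← LinearMap.lTensor_comp]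
      simp⟩
  hom_inv_id := by ext; simp
  inv_hom_id := by ext; simp

/-- The tensor product, with diagonal action and codiagonal coaction. -/
abbrev tensor (X Y : YD k D) : YD k D where
  carrier := X.carrier ⊗[k] Y.carrier
  act := tensorAct X.act Y.act
  coact := tensorCoact X.coact Y.coact
  isCoaction :=
    ⟨tensorCoact_coassoc X.isCoaction.coassoc Y.isCoaction.coassoc,
      tensorCoact_counit X.isCoaction.counit Y.isCoaction.counit⟩
  compatible := X.compatible.tensor Y.compatible

/-- The unit object `k`, with trivial action and coaction. -/
abbrev unit : YD k D where
  carrier := k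
  act := trivialAct
  coact := trivialCoact
  isCoaction :=
    ⟨by simp [trivialCoact, Algebra.TensorProduct.one_def], by simp [trivialCoact]⟩
  compatible := trivial_compatible


/-- The tensor product of morphisms. -/
def tensorMap {X₁ Y₁ X₂ Y₂ : YD k D} (f : X₁ ⟶ Y₁) (g : X₂ ⟶ Y₂) :
    tensor X₁ X₂ ⟶ tensor Y₁ Y₂ where
  lin := TensorProduct.map f.lin g.lin
  map_act := map_tensorAct _ _ f.map_act g.map_act
  map_coact := map_tensorCoact _ _ f.map_coact g.map_coact

instance : MonoidalCategoryStruct (YD k D) where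
  tensorObj := tensor
  tensorHom := tensorMap
  whiskerLeft X _ _ f := tensorMap (𝟙 X) f
  whiskerRight f Y := tensorMap f (𝟙 Y)
  tensorUnit := unit
  associator X Y Z := isoMk (TensorProduct.assoc k X.carrier Y.carrier Z.carrier)
    (assoc_tensorAct _ _ _) (assoc_tensorCoact _ _ _)
  leftUnitor X := isoMk (TensorProduct.lid k X.carrier) (lid_tensorAct (k := k) _)
    (lid_tensorCoact (k := k) _)
  rightUnitor X := isoMk (TensorProduct.rid k X.carrier) (rid_tensorAct (k := k) _)
    (rid_tensorCoact (k := k) _)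

theorem tensorHom_lin {X₁ Y₁ X₂ Y₂ : YD k D} (f : X₁ ⟶ Y₁) (g : X₂ ⟶ Y₂) :
    (f ⊗ₘ g).lin = TensorProduct.map f.lin g.lin := rfl

instance : MonoidalCategory (YD k D) where
  tensorHom_def f g := hom_ext (TensorProduct.ext' fun _ _ => rfl)
  id_tensorHom_id X Y := hom_ext (TensorProduct.ext' fun _ _ => rfl)
  tensorHom_comp_tensorHom f g h i := hom_ext (TensorProduct.ext' fun _ _ => rfl)
  whiskerLeft_id X Y := hom_ext (TensorProduct.ext' fun _ _ => rfl)
  id_whiskerRight X Y := hom_ext (TensorProduct.ext' fun _ _ => rfl)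
  associator_naturality f g h := hom_ext (TensorProduct.ext_threefold fun _ _ _ => rfl)
  leftUnitor_naturality f := hom_ext (TensorProduct.ext' fun c v =>
    (f.lin.map_smul (id c : k) v).symm)
  rightUnitor_naturality f := hom_ext (TensorProduct.ext' fun v c =>
    (f.lin.map_smul (id c : k) v).symm)
  pentagon W X Y Z := hom_ext (TensorProduct.ext_fourfold fun _ _ _ _ => rfl)
  triangle X Y := hom_ext (TensorProduct.ext_threefold fun x c y =>
    (TensorProduct.smul_tmul (id c : k) x y).symm)


/-- The braiding `C (x ⊗ y) = x₍₋₁₎ · y ⊗ x₍₀₎` of Yetter–Drinfeld modules. -/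
def braid (X Y : YD k D) : X ⊗ Y ⟶ Y ⊗ X where
  lin := braidLin X.coact Y.act
  map_act := braidLin_act _ X.compatible
  map_coact := braidLin_coact X.isCoaction.coassoc Y.compatible


/-- The morphism `W ⊗ C ⊗ Z` from `(W ⊗ X) ⊗ (Y ⊗ Z)` to `(W ⊗ Y) ⊗ (X ⊗ Z)`. -/
def midSwap (W X Y Z : YD k D) : (W ⊗ X) ⊗ (Y ⊗ Z) ⟶ (W ⊗ Y) ⊗ (X ⊗ Z) :=
  (α_ W X (Y ⊗ Z)).hom ≫ W ◁ ((α_ X Y Z).inv ≫ braid X Y ▷ Z ≫ (α_ Y X Z).hom) ≫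
    (α_ W Y (X ⊗ Z)).inv

open Limits MonObj ComonObj

/-- A braided Hopf algebra: a Hopf algebra in the category of Yetter–Drinfeld modules. -/
class BraidedHopf (H : YD k D) extends MonObj H, ComonObj H where
  mul_counit : μ[H] ≫ ε[H] = (ε[H] ⊗ₘ ε[H]) ≫ (λ_ (𝟙_ (YD k D))).hom
  one_counit : η[H] ≫ ε[H] = 𝟙 (𝟙_ (YD k D))
  mul_comul : μ[H] ≫ Δ[H] = (Δ[H] ⊗ₘ Δ[H]) ≫ midSwap H H H H ≫ (μ[H] ⊗ₘ μ[H])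
  one_comul : η[H] ≫ Δ[H] = (λ_ (𝟙_ (YD k D))).inv ≫ (η[H] ⊗ₘ η[H])
  /-- the antipode -/
  antipode : H ⟶ H
  antipode_left : Δ[H] ≫ antipode ▷ H ≫ μ[H] = ε[H] ≫ η[H]
  antipode_right : Δ[H] ≫ H ◁ antipode ≫ μ[H] = ε[H] ≫ η[H]

variable {H B A : YD k D} [BraidedHopf H] [MonObj B] [MonObj A]

/-! ### Crossed products -/

/-- The morphism `h ⊗ g ↦ f (h₁ ⊗ g₁) ⊗ f' (h₂ ⊗ g₂)`, with the comultiplication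
`(H ⊗ C ⊗ H) (Δ ⊗ Δ)` of `H ⊗ H`. -/
def comulTensor {X Y : YD k D} (f : H ⊗ H ⟶ X) (f' : H ⊗ H ⟶ Y) : H ⊗ H ⟶ X ⊗ Y :=
  (Δ[H] ⊗ₘ Δ[H]) ≫ midSwap H H H H ≫ (f ⊗ₘ f')

/-- `act : H ⊗ B ⟶ B` is a weak action of `H` on the algebra `B`. -/
structure IsWeakAction (act : H ⊗ B ⟶ B) : Prop where
  act_mul : H ◁ μ[B] ≫ act = Δ[H] ▷ (B ⊗ B) ≫ midSwap H H B B ≫ (act ⊗ₘ act) ≫ μ[B]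
  act_one : H ◁ η[B] ≫ act = (ρ_ H).hom ≫ ε[H] ≫ η[B]

/-- `σ : H ⊗ H ⟶ B` is a (normalised) 2-cocycle with respect to `act : H ⊗ B ⟶ B`. -/
structure IsTwoCocycle (act : H ⊗ B ⟶ B) (σ : H ⊗ H ⟶ B) : Prop where
  cocycle : (Δ[H] ⊗ₘ comulTensor σ μ[H]) ≫ midSwap H H B H ≫ (act ⊗ₘ σ) ≫ μ[B] =
    (α_ H H H).inv ≫ comulTensor σ μ[H] ▷ H ≫ (α_ B H H).hom ≫ B ◁ σ ≫ μ[B]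
  right_one : H ◁ η[H] ≫ σ = (ρ_ H).hom ≫ ε[H] ≫ η[B]
  left_one : η[H] ▷ H ≫ σ = (λ_ H).hom ≫ ε[H] ≫ η[B]

/-- `σ : H ⊗ H ⟶ B` is invertible with respect to the convolution product. -/
def ConvInvertible (σ : H ⊗ H ⟶ B) : Prop :=
  ∃ τ : H ⊗ H ⟶ B,
    comulTensor σ τ ≫ μ[B] = (ε[H] ⊗ₘ ε[H]) ≫ (λ_ (𝟙_ (YD k D))).hom ≫ η[B] ∧
    comulTensor τ σ ≫ μ[B] = (ε[H] ⊗ₘ ε[H]) ≫ (λ_ (𝟙_ (YD k D))).hom ≫ η[B]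

/-- The multiplication `(b # h) (c # g) = b (h₁ · c) σ (h₂, g₁) # h₃ g₂` of `B #_σ H`,
whose underlying object is `B ⊗ H`. -/
def crossedMul (act : H ⊗ B ⟶ B) (σ : H ⊗ H ⟶ B) : (B ⊗ H) ⊗ (B ⊗ H) ⟶ B ⊗ H :=
  (B ◁ Δ[H]) ▷ (B ⊗ H) ≫ (α_ B (H ⊗ H) (B ⊗ H)).hom ≫ B ◁ midSwap H H B H ≫
    B ◁ (act ⊗ₘ comulTensor σ μ[H]) ≫ (α_ B B (B ⊗ H)).inv ≫ μ[B] ▷ (B ⊗ H) ≫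
      (α_ B B H).inv ≫ μ[B] ▷ H

/-- The unit of `B #_σ H`. -/
def crossedOne (B H : YD k D) [BraidedHopf H] [MonObj B] :
    𝟙_ (YD k D) ⟶ B ⊗ H :=
  (λ_ (𝟙_ (YD k D))).inv ≫ (η[B] ⊗ₘ η[H])

/-- `e` identifies the algebra `A` with `B #_σ H`. (In particular, `B #_σ H` is associative and
unital, so `act` and `σ` also satisfy the twisted module condition.) -/
structure IsCrossedProductIso (act : H ⊗ B ⟶ B) (σ : H ⊗ H ⟶ B) (e : B ⊗ H ≅ A) : Prop where
  mul : crossedMul act σ ≫ e.hom = (e.hom ⊗ₘ e.hom) ≫ μ[A]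
  one : crossedOne B H ≫ e.hom = η[A]

/-! ### Galois extensions -/

/-- `ψ : A ⟶ A ⊗ H` makes the algebra `A` a right `H`-comodule algebra. -/
structure IsComoduleAlgebra (ψ : A ⟶ A ⊗ H) : Prop where
  counit : ψ ≫ A ◁ ε[H] = (ρ_ A).inv
  coassoc : ψ ≫ ψ ▷ H ≫ (α_ A H H).hom = ψ ≫ A ◁ Δ[H]
  mul : μ[A] ≫ ψ = (ψ ⊗ₘ ψ) ≫ midSwap A H A H ≫ (μ[A] ⊗ₘ μ[H])
  one : η[A] ≫ ψ = (λ_ (𝟙_ (YD k D))).inv ≫ (η[A] ⊗ₘ η[H])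

/-- `p : B ⟶ A` is the coinvariants of `A`: the equaliser of `ψ` and `A ⊗ η`. -/
def IsCoinvariants (ψ : A ⟶ A ⊗ H) (p : B ⟶ A) : Prop :=
  ∃ w : p ≫ ψ = p ≫ (ρ_ A).inv ≫ A ◁ η[H], Nonempty (IsLimit (Fork.ofι p w))

/-- `q : A ⊗ A ⟶ Q` is the tensor product of `A` with itself over `B`, along `p : B ⟶ A`: the
coequaliser of `(m ⊗ A) (A ⊗ p ⊗ A)` and `(A ⊗ m) (A ⊗ p ⊗ A)`. -/
def IsTensorOver (p : B ⟶ A) {Q : YD k D} (q : A ⊗ A ⟶ Q) : Prop :=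
  ∃ w : ((A ◁ p ≫ μ[A]) ▷ A) ≫ q = ((α_ A B A).hom ≫ A ◁ (p ▷ A ≫ μ[A])) ≫ q,
    Nonempty (IsColimit (Cofork.ofπ q w))

/-- The morphism `(m ⊗ H) (A ⊗ ψ)`, that is, `a ⊗ a' ↦ a a'₍₀₎ ⊗ a'₍₁₎`. -/
def preCan (ψ : A ⟶ A ⊗ H) : A ⊗ A ⟶ A ⊗ H :=
  A ◁ ψ ≫ (α_ A A H).inv ≫ μ[A] ▷ H

/-- The canonical morphism `can : A ⊗_B A ⟶ A ⊗ H` induced by `preCan ψ` is an isomorphism. -/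
def IsGalois (ψ : A ⟶ A ⊗ H) {Q : YD k D} (q : A ⊗ A ⟶ Q) : Prop :=
  ∃ can : Q ≅ A ⊗ H, q ≫ can.hom = preCan ψ

/-- `e : B ⊗ H ⟶ A` is left `B`-linear, where `B` acts on `B ⊗ H` by `m ⊗ H`, and on `A`
along `p`. -/
def IsLeftLinear (p : B ⟶ A) (e : B ⊗ H ⟶ A) : Prop :=
  ((α_ B B H).inv ≫ μ[B] ▷ H) ≫ e = B ◁ e ≫ (p ▷ A ≫ μ[A])

/-- `e : B ⊗ H ⟶ A` is right `H`-colinear, where `H` coacts on `B ⊗ H` by `B ⊗ Δ`, and on `A`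
by `ψ`. -/
def IsRightColinear (ψ : A ⟶ A ⊗ H) (e : B ⊗ H ⟶ A) : Prop :=
  e ≫ ψ = (B ◁ Δ[H] ≫ (α_ B H H).inv) ≫ e ▷ H

/-- `(A, ψ)` is a right `H`-comodule algebra whose algebra of coinvariants is `p : B ⟶ A`,
the extension `A / B` is Galois, the canonical epimorphism `q : A ⊗ A ⟶ A ⊗_B A` is split, and `A`
is isomorphic to `B ⊗ H` as left `B`-module and right `H`-comodule. -/
structure IsSplitGaloisWithNormalBasis (ψ : A ⟶ A ⊗ H) (p : B ⟶ A) : Prop where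
  comoduleAlgebra : IsComoduleAlgebra ψ
  isMonHom : IsMonHom p
  coinvariants : IsCoinvariants ψ p
  galois : ∃ (Q : YD k D) (q : A ⊗ A ⟶ Q), IsTensorOver p q ∧ IsGalois ψ q ∧ IsSplitEpi q
  normalBasis : ∃ e : B ⊗ H ≅ A, IsLeftLinear p e.hom ∧ IsRightColinear ψ e.hom

end YD

end YetterDrinfeld

end

/-!
Part (a) holds because the kernel and the image of `f - g` are Yetter–Drinfeld submodules; for the
kernel this uses that `D ⊗ -` is exact over a field. The universal properties are then checked on
underlying vector spaces (`isLimit_iff`, `isColimit_iff`).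

For part (b), the braiding is only used through naturality, the unit laws and the two hexagons
(`braid_tensor_left`, `braid_tensor_right`), and not through its inverse, which need not exist as
the antipode of `D` need not be bijective. Computations are then equalities of string diagrams.

The link between the two conditions is a pair `p : B ⟶ A`, `j : H ⟶ A` such that
`e : b ⊗ h ↦ p(b) j(h)` is an isomorphism, with the commutation rules of `b ↦ b # 1` and
`h ↦ 1 # h`: `j(h) p(b) = p(h₁ · b') j(h₂')` and `j(h) j(g) = p(σ(h₁, g₁')) j(h₂' g₂)`
(`IsCrossedPair`). A crossed product yields such a pair (`IsCrossedProductIso.isCrossedPair`).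
Conversely such a pair makes `e` an isomorphism from the crossed product, and associativity of `A`,
read off on `B`-components, says that `act` is a weak action and `σ` a cocycle. If `A` is a
comodule algebra with a unital normal basis `e`, then `e⁻¹` is determined by its `B`-component, as
`e` is colinear, and the rules hold for the `B`-components of `j(h) p(b)` and `j(h) j(g)`
(`IsComoduleAlgebra.isCrossedPair`). A normal basis can always be made unital
(`IsSplitGaloisWithNormalBasis.exists_normalised`).

It remains to compare the Galois condition with invertibility of `σ`. Given `e`, the object `A ⊗ H`
with the map `a ⊗ p(b) j(h) ↦ a p(b) ⊗ h` is a split coequaliser, hence is `A ⊗_B A` with split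
canonical epimorphism (`tensorOverSplit`). So the Galois condition says that `a ⊗ h ↦ a j(h₁) ⊗ h₂`
is an isomorphism (`galois_iff`). Along `e`, this map is `b ⊗ h ⊗ g ↦ b σ(h₁, g₁') ⊗ h₂' ⊗ g₂`
followed by `h ⊗ g ↦ h g₁ ⊗ g₂` (`IsCrossedPair.canonical_eq`). Both are twists
`b ⊗ x ↦ b f(x₁) ⊗ x₂` for a morphism `f` from a comonoid to a monoid, and a twist is an
isomorphism if and only if `f` is convolution invertible (`isIso_twist_iff`). The second one is
invertible by the antipode of `H`.
-/

open CategoryTheory MonoidalCategory Limits MonObj ComonObj YetterDrinfeld YetterDrinfeld.YD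

noncomputable section

/-! ### Equalisers and coequalisers of Yetter–Drinfeld modules -/

namespace YetterDrinfeld

section Transfer

variable {k D V W : Type u} [Field k] [Ring D] [HopfAlgebra k D]
  [AddCommGroup V] [Module k V] [AddCommGroup W] [Module k W]
  {f : D →ₐ[k] Module.End k V} {g : D →ₐ[k] Module.End k W}
  {ρ : V →ₗ[k] D ⊗[k] V} {σ : W →ₗ[k] D ⊗[k] W} (φ : V →ₗ[k] W)

/-- Both sides of coassociativity of `σ` at `φ v` are the images of those of `ρ` at `v`. -/
theorem coassoc_lTensor (hφ : ∀ v, σ (φ v) = φ.lTensor D (ρ v)) (v : V) :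
    TensorProduct.assoc k D D W (Coalgebra.comul.rTensor W (σ (φ v))) =
        (φ.lTensor D).lTensor D
          (TensorProduct.assoc k D D V (Coalgebra.comul.rTensor V (ρ v))) ∧
      σ.lTensor D (σ (φ v)) = (φ.lTensor D).lTensor D (ρ.lTensor D (ρ v)) := by
  rw [hφ]
  constructor
  · induction ρ v with
    | zero => simp
    | add x y hx hy => simp only [map_add, hx, hy]
    | tmul a v =>
      simp only [LinearMap.lTensor_tmul, LinearMap.rTensor_tmul]
      induction Coalgebra.comul (R := k) a with
      | zero => simp
      | add x y hx hy => simp only [map_add, TensorProduct.add_tmul, hx, hy]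
      | tmul a b => simp
  · rw [← LinearMap.lTensor_comp_apply, ← LinearMap.lTensor_comp_apply,
      show σ ∘ₗ φ = φ.lTensor D ∘ₗ ρ from LinearMap.ext hφ]

theorem counit_lTensor (hφ : ∀ v, σ (φ v) = φ.lTensor D (ρ v)) (v : V) :
    TensorProduct.lid k W (Coalgebra.counit.rTensor W (σ (φ v))) =
      φ (TensorProduct.lid k V (Coalgebra.counit.rTensor V (ρ v))) := by
  rw [hφ]
  induction ρ v with
  | zero => simp
  | add x y hx hy => simp only [map_add, hx, hy]
  | tmul a v => simp

/-- Both sides of the Yetter–Drinfeld condition at `φ v` are the images of those at `v`. -/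
theorem compatible_lTensor (hf : ∀ d v, φ (f d v) = g d (φ v))
    (hφ : ∀ v, σ (φ v) = φ.lTensor D (ρ v)) (d : D) (v : V) :
    tensorAct (Algebra.lmul k D) g d (σ (φ v)) =
        φ.lTensor D (tensorAct (Algebra.lmul k D) f d (ρ v)) ∧
      TensorProduct.lift (coactActMul g σ (φ v)) (Coalgebra.comul (R := k) d) =
        φ.lTensor D (TensorProduct.lift (coactActMul f ρ v) (Coalgebra.comul (R := k) d)) := by
  constructor
  · rw [hφ]
    exact (map_tensorAct LinearMap.id φ (fun _ _ => rfl) hf d (ρ v)).symm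
  · induction Coalgebra.comul (R := k) d with
    | zero => simp
    | add x y hx hy => simp only [map_add, hx, hy]
    | tmul a b =>
      rw [TensorProduct.lift.tmul, TensorProduct.lift.tmul, coactActMul_apply, coactActMul_apply,
        ← hf, hφ, ← LinearMap.comp_apply, LinearMap.rTensor_comp_lTensor,
        ← LinearMap.lTensor_comp_rTensor, LinearMap.comp_apply]

theorem lTensor_injective {φ : V →ₗ[k] W} (h : Function.Injective φ) :
    Function.Injective (φ.lTensor D) :=
  Module.Flat.lTensor_preserves_injective_linearMap φ h

theorem IsCoaction.of_injective (h : IsCoaction σ) (hi : Function.Injective φ)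
    (hφ : ∀ v, σ (φ v) = φ.lTensor D (ρ v)) : IsCoaction ρ where
  coassoc v := by
    apply lTensor_injective (D := D) (lTensor_injective (D := D) hi)
    rw [← (coassoc_lTensor φ hφ v).1, ← (coassoc_lTensor φ hφ v).2, h.coassoc]
  counit v := hi <| by rw [← counit_lTensor φ hφ, h.counit]

theorem IsCoaction.of_surjective (h : IsCoaction ρ) (hs : Function.Surjective φ)
    (hφ : ∀ v, σ (φ v) = φ.lTensor D (ρ v)) : IsCoaction σ where
  coassoc w := by
    obtain ⟨v, rfl⟩ := hs w
    rw [(coassoc_lTensor φ hφ v).1, (coassoc_lTensor φ hφ v).2, h.coassoc]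
  counit w := by
    obtain ⟨v, rfl⟩ := hs w
    rw [counit_lTensor φ hφ, h.counit]

theorem Compatible.of_injective (h : Compatible g σ) (hi : Function.Injective φ)
    (hf : ∀ d v, φ (f d v) = g d (φ v)) (hφ : ∀ v, σ (φ v) = φ.lTensor D (ρ v)) :
    Compatible f ρ := fun d v => lTensor_injective hi <| by
  rw [← (compatible_lTensor φ hf hφ d v).1, ← (compatible_lTensor φ hf hφ d v).2, h]

theorem Compatible.of_surjective (h : Compatible f ρ) (hs : Function.Surjective φ)
    (hf : ∀ d v, φ (f d v) = g d (φ v)) (hφ : ∀ v, σ (φ v) = φ.lTensor D (ρ v)) :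
    Compatible g σ := fun d w => by
  obtain ⟨v, rfl⟩ := hs w
  rw [(compatible_lTensor φ hf hφ d v).1, (compatible_lTensor φ hf hφ d v).2, h]

end Transfer

namespace YD

variable {k D : Type u} [Field k] [Ring D] [HopfAlgebra k D]

/-- A morphism that factors as a linear map through an injective morphism factors through it in
the category of Yetter–Drinfeld modules. -/
theorem exists_lift_of_injective {E X Z : YD k D} {e : E ⟶ X} (he : Function.Injective e.lin)
    (h : Z ⟶ X) (hr : ∀ z, h.lin z ∈ LinearMap.range e.lin) : ∃ l : Z ⟶ E, l ≫ e = h := by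
  let l : Z.carrier →ₗ[k] E.carrier :=
    (LinearEquiv.ofInjective e.lin he).symm.toLinearMap ∘ₗ h.lin.codRestrict _ hr
  have hl (z) : e.lin (l z) = h.lin z :=
    congrArg Subtype.val ((LinearEquiv.ofInjective e.lin he).apply_symm_apply ⟨h.lin z, hr z⟩)
  refine ⟨⟨l, fun d z => he ?_, fun z => lTensor_injective (D := D) he ?_⟩,
    hom_ext (LinearMap.ext hl)⟩
  · rw [e.map_act, hl, hl, h.map_act]
  · rw [← e.map_coact, hl, h.map_coact, ← LinearMap.lTensor_comp_apply,
      show e.lin ∘ₗ l = h.lin from LinearMap.ext hl]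

/-- A morphism that factors as a linear map through a surjective morphism factors through it in
the category of Yetter–Drinfeld modules. -/
theorem exists_desc_of_surjective {X Q Z : YD k D} {q : X ⟶ Q} (hq : Function.Surjective q.lin)
    (h : X ⟶ Z) (hk : LinearMap.ker q.lin ≤ LinearMap.ker h.lin) : ∃ l : Q ⟶ Z, q ≫ l = h := by
  let l : Q.carrier →ₗ[k] Z.carrier :=
    (LinearMap.ker q.lin).liftQ h.lin hk ∘ₗ
      (q.lin.quotKerEquivOfSurjective hq).symm.toLinearMap
  have hl (x) : l (q.lin x) = h.lin x := by
    have : (q.lin.quotKerEquivOfSurjective hq).symm (q.lin x) = Submodule.Quotient.mk x := by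
      rw [LinearEquiv.symm_apply_eq]; rfl
    simp only [l, LinearMap.comp_apply, LinearEquiv.coe_coe, this]
    rfl
  refine ⟨⟨l, fun d z => ?_, fun z => ?_⟩, hom_ext (LinearMap.ext hl)⟩
  · obtain ⟨x, rfl⟩ := hq z
    rw [← q.map_act, hl, hl, h.map_act]
  · obtain ⟨x, rfl⟩ := hq z
    rw [q.map_coact, hl, h.map_coact, ← LinearMap.lTensor_comp_apply,
      show l ∘ₗ q.lin = h.lin from LinearMap.ext hl]

theorem mono_of_injective {E X : YD k D} {e : E ⟶ X} (he : Function.Injective e.lin) :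
    Mono e where
  right_cancellation a b hab := hom_ext <| LinearMap.ext fun z => he <|
    LinearMap.congr_fun (congrArg Hom.lin hab) z

theorem epi_of_surjective {X Q : YD k D} {q : X ⟶ Q} (hq : Function.Surjective q.lin) :
    Epi q where
  left_cancellation a b hab := hom_ext <| LinearMap.ext fun z => by
    obtain ⟨x, rfl⟩ := hq z
    exact LinearMap.congr_fun (congrArg Hom.lin hab) x

theorem lin_eq_of_comp_eq {E X Y : YD k D} {f g : X ⟶ Y} {e : E ⟶ X} (he : e ≫ f = e ≫ g)
    (x : E.carrier) : f.lin (e.lin x) = g.lin (e.lin x) :=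
  LinearMap.congr_fun (congrArg Hom.lin he) x

theorem isLimit_of_range_eq_ker {E X Y : YD k D} (f g : X ⟶ Y) (e : E ⟶ X) (he : e ≫ f = e ≫ g)
    (hi : Function.Injective e.lin)
    (hr : LinearMap.range e.lin = LinearMap.ker (f.lin - g.lin)) :
    Nonempty (IsLimit (Fork.ofι e he)) := by
  have := mono_of_injective hi
  have key (s : Fork f g) : ∃ l : s.pt ⟶ E, l ≫ e = s.ι :=
    exists_lift_of_injective hi s.ι fun z => by
      rw [hr, LinearMap.mem_ker, LinearMap.sub_apply, sub_eq_zero]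
      exact lin_eq_of_comp_eq s.condition z
  choose l hl using key
  exact ⟨Fork.IsLimit.mk _ l hl fun s m hm => (cancel_mono e).1 (hm.trans (hl s).symm)⟩

theorem isColimit_of_ker_eq_range {X Y Q : YD k D} (f g : X ⟶ Y) (q : Y ⟶ Q)
    (hq : f ≫ q = g ≫ q) (hs : Function.Surjective q.lin)
    (hk : LinearMap.ker q.lin = LinearMap.range (f.lin - g.lin)) :
    Nonempty (IsColimit (Cofork.ofπ q hq)) := by
  have := epi_of_surjective hs
  have key (s : Cofork f g) : ∃ l : Q ⟶ s.pt, q ≫ l = s.π :=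
    exists_desc_of_surjective hs s.π <| by
      rw [hk]
      rintro _ ⟨x, rfl⟩
      rw [LinearMap.mem_ker, LinearMap.sub_apply, map_sub, sub_eq_zero]
      exact LinearMap.congr_fun (congrArg Hom.lin s.condition) x
  choose l hl using key
  exact ⟨Cofork.IsColimit.mk _ l hl fun s m hm => (cancel_epi q).1 (hm.trans (hl s).symm)⟩

/-- The kernel of `f - g` is a Yetter–Drinfeld submodule: it is preserved by the coaction because
`D ⊗ -` is exact. -/
theorem exists_equalizer {X Y : YD k D} (f g : X ⟶ Y) : ∃ (E : YD k D) (e : E ⟶ X),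
    e ≫ f = e ≫ g ∧ Function.Injective e.lin ∧
      LinearMap.range e.lin = LinearMap.ker (f.lin - g.lin) := by
  let K := LinearMap.ker (f.lin - g.lin)
  have hK (x : X.carrier) : x ∈ K ↔ f.lin x = g.lin x := by
    rw [LinearMap.mem_ker, LinearMap.sub_apply, sub_eq_zero]
  let act : D →ₐ[k] Module.End k K := AlgHom.ofLinearMap
    { toFun d := (X.act d).restrict (p := K) (q := K) fun x hx => by
        rw [hK] at hx ⊢
        rw [f.map_act, g.map_act, hx]
      map_add' a b := by ext; simp
      map_smul' c a := by ext; simp }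
    (by ext; simp) (fun a b => by ext; simp)
  have hi := lTensor_injective (D := D) K.injective_subtype
  have hr (x : K) : X.coact x ∈ LinearMap.range (K.subtype.lTensor D) := by
    have hex : Function.Exact K.subtype (f.lin - g.lin) := fun y => by
      simp [K]
    rw [← LinearMap.exact_iff.1 (Module.Flat.lTensor_exact D hex), LinearMap.mem_ker,
      LinearMap.lTensor_sub, LinearMap.sub_apply, ← f.map_coact, ← g.map_coact, (hK x).1 x.2,
      sub_self]
  let coact : K →ₗ[k] D ⊗[k] K :=
    (LinearEquiv.ofInjective _ hi).symm.toLinearMap ∘ₗ (X.coact ∘ₗ K.subtype).codRestrict _ hr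
  have hc (x : K) : X.coact (K.subtype x) = K.subtype.lTensor D (coact x) :=
    (congrArg Subtype.val ((LinearEquiv.ofInjective _ hi).apply_symm_apply ⟨X.coact x, hr x⟩)).symm
  let E : YD k D :=
    { carrier := K
      act := act
      coact := coact
      isCoaction := X.isCoaction.of_injective K.subtype K.injective_subtype hc
      compatible := X.compatible.of_injective K.subtype K.injective_subtype (fun _ _ => rfl) hc }
  exact ⟨E, ⟨K.subtype, fun _ _ => rfl, hc⟩, hom_ext (LinearMap.ext fun x => (hK x).1 x.2),
    K.injective_subtype, K.range_subtype⟩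

/-- The image of `f - g` is a Yetter–Drinfeld submodule, and the quotient by it is again a
Yetter–Drinfeld module. -/
theorem exists_coequalizer {X Y : YD k D} (f g : X ⟶ Y) : ∃ (Q : YD k D) (q : Y ⟶ Q),
    f ≫ q = g ≫ q ∧ Function.Surjective q.lin ∧
      LinearMap.ker q.lin = LinearMap.range (f.lin - g.lin) := by
  let R := LinearMap.range (f.lin - g.lin)
  have hR (x : X.carrier) : R.mkQ (f.lin x) = R.mkQ (g.lin x) :=
    (Submodule.Quotient.eq R).2 ⟨x, rfl⟩
  let act : D →ₐ[k] Module.End k (Y.carrier ⧸ R) := AlgHom.ofLinearMap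
    { toFun d := R.mapQ R (Y.act d) <| by
        rintro _ ⟨x, rfl⟩
        refine ⟨X.act d x, ?_⟩
        simp [f.map_act, g.map_act]
      map_add' a b := by ext; simp
      map_smul' c a := by ext; simp }
    (by ext; simp) (fun a b => by ext; simp)
  let coact : (Y.carrier ⧸ R) →ₗ[k] D ⊗[k] (Y.carrier ⧸ R) :=
    R.liftQ (R.mkQ.lTensor D ∘ₗ Y.coact) <| by
      rintro _ ⟨x, rfl⟩
      rw [LinearMap.mem_ker, LinearMap.comp_apply, LinearMap.sub_apply, map_sub, f.map_coact,
        g.map_coact, map_sub, ← LinearMap.lTensor_comp_apply, ← LinearMap.lTensor_comp_apply,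
        show R.mkQ ∘ₗ f.lin = R.mkQ ∘ₗ g.lin from LinearMap.ext hR, sub_self]
  let Q : YD k D :=
    { carrier := Y.carrier ⧸ R
      act := act
      coact := coact
      isCoaction := Y.isCoaction.of_surjective R.mkQ R.mkQ_surjective fun _ => rfl
      compatible := Y.compatible.of_surjective R.mkQ R.mkQ_surjective (fun _ _ => rfl)
        fun _ => rfl }
  exact ⟨Q, ⟨R.mkQ, fun _ _ => rfl, fun _ => rfl⟩, hom_ext (LinearMap.ext hR),
    R.mkQ_surjective, R.ker_mkQ⟩

instance : HasEqualizers (YD k D) :=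
  have (X Y : YD k D) (f g : X ⟶ Y) : HasLimit (parallelPair f g) := by
    obtain ⟨E, e, he, hi, hr⟩ := exists_equalizer f g
    exact ⟨⟨_, (isLimit_of_range_eq_ker f g e he hi hr).some⟩⟩
  hasEqualizers_of_hasLimit_parallelPair _

instance : HasCoequalizers (YD k D) :=
  have (X Y : YD k D) (f g : X ⟶ Y) : HasColimit (parallelPair f g) := by
    obtain ⟨Q, q, hq, hs, hk⟩ := exists_coequalizer f g
    exact ⟨⟨_, (isColimit_of_ker_eq_range f g q hq hs hk).some⟩⟩
  hasCoequalizers_of_hasColimit_parallelPair _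

/-- The linear equivalence underlying an isomorphism. -/
def isoLin {X Y : YD k D} (i : X ≅ Y) : X.carrier ≃ₗ[k] Y.carrier :=
  LinearEquiv.ofLinearMap i.hom.lin i.inv.lin (congrArg Hom.lin i.inv_hom_id)
    (congrArg Hom.lin i.hom_inv_id)

theorem isLimit_iff {E X Y : YD k D} (f g : X ⟶ Y) (e : E ⟶ X) (he : e ≫ f = e ≫ g) :
    Nonempty (IsLimit (Fork.ofι e he)) ↔
      Function.Injective e.lin ∧ LinearMap.range e.lin = LinearMap.ker (f.lin - g.lin) := by
  refine ⟨fun ⟨h⟩ => ?_, fun h => isLimit_of_range_eq_ker f g e he h.1 h.2⟩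
  obtain ⟨E', e', he', hi, hr⟩ := exists_equalizer f g
  obtain ⟨h'⟩ := isLimit_of_range_eq_ker f g e' he' hi hr
  let i : E ≅ E' := h.conePointUniqueUpToIso h'
  have hie : i.hom ≫ e' = e := h.conePointUniqueUpToIso_hom_comp h' WalkingParallelPair.zero
  have hlin : e'.lin ∘ₗ (isoLin i).toLinearMap = e.lin := congrArg Hom.lin hie
  rw [← hlin]
  refine ⟨hi.comp (isoLin i).injective, ?_⟩
  rw [LinearMap.range_comp, LinearEquiv.range, Submodule.map_top, hr]

theorem isColimit_iff {X Y Q : YD k D} (f g : X ⟶ Y) (q : Y ⟶ Q) (hq : f ≫ q = g ≫ q) :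
    Nonempty (IsColimit (Cofork.ofπ q hq)) ↔
      Function.Surjective q.lin ∧ LinearMap.ker q.lin = LinearMap.range (f.lin - g.lin) := by
  refine ⟨fun ⟨h⟩ => ?_, fun h => isColimit_of_ker_eq_range f g q hq h.1 h.2⟩
  obtain ⟨Q', q', hq', hs, hk⟩ := exists_coequalizer f g
  obtain ⟨h'⟩ := isColimit_of_ker_eq_range f g q' hq' hs hk
  let i : Q' ≅ Q := h'.coconePointUniqueUpToIso h
  have hie : q' ≫ i.hom = q := h'.comp_coconePointUniqueUpToIso_hom h WalkingParallelPair.one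
  have hlin : (isoLin i).toLinearMap ∘ₗ q'.lin = q.lin := congrArg Hom.lin hie
  rw [← hlin]
  refine ⟨(isoLin i).surjective.comp hs, ?_⟩
  rw [LinearEquiv.ker_comp, hk]

end YD
end YetterDrinfeld

/-! ### The braiding and tensor products of comonoids -/

namespace YetterDrinfeld.YD

variable {k D : Type u} [Field k] [Ring D] [HopfAlgebra k D]

theorem braid_naturality {X X' Y Y' : YD k D} (f : X ⟶ X') (g : Y ⟶ Y') :
    (f ⊗ₘ g) ≫ braid X' Y' = braid X Y ≫ (g ⊗ₘ f) := by
  refine hom_ext (TensorProduct.ext' fun x y => ?_)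
  change braidLin X'.coact Y'.act (f.lin x ⊗ₜ g.lin y) =
    TensorProduct.map g.lin f.lin (braidLin X.coact Y.act (x ⊗ₜ y))
  rw [braidLin_tmul, braidLin_tmul, f.map_coact]
  induction X.coact x with
  | zero => simp
  | add a b ha hb => simp only [map_add, ha, hb]
  | tmul a v => simp [g.map_act]

theorem braid_naturality_left {X X' : YD k D} (f : X ⟶ X') (Y : YD k D) :
    f ▷ Y ≫ braid X' Y = braid X Y ≫ Y ◁ f := by
  simpa using braid_naturality f (𝟙 Y)

theorem braid_naturality_right (X : YD k D) {Y Y' : YD k D} (g : Y ⟶ Y') :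
    X ◁ g ≫ braid X Y' = braid X Y ≫ g ▷ X := by
  simpa using braid_naturality (𝟙 X) g

/-- The hexagon for `C (X ⊗ Y, Z)`; it holds because the coaction on a tensor product is
codiagonal. -/
theorem braid_tensor_left (X Y Z : YD k D) :
    braid (X ⊗ Y) Z = (α_ X Y Z).hom ≫ X ◁ braid Y Z ≫ (α_ X Z Y).inv ≫
      braid X Z ▷ Y ≫ (α_ Z X Y).hom := by
  refine hom_ext (TensorProduct.ext_threefold fun x y z => ?_)
  change braidLin (tensorCoact X.coact Y.coact) Z.act ((x ⊗ₜ y) ⊗ₜ z) =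
    TensorProduct.assoc k Z.carrier X.carrier Y.carrier
      ((braidLin X.coact Z.act).rTensor Y.carrier
        ((TensorProduct.assoc k X.carrier Z.carrier Y.carrier).symm
          (x ⊗ₜ braidLin Y.coact Z.act (y ⊗ₜ z))))
  rw [braidLin_tmul, braidLin_tmul, tensorCoact_tmul]
  induction Y.coact y with
  | zero => simp
  | add a b ha hb => simp only [map_add, ha, hb, TensorProduct.tmul_add]
  | tmul b y =>
    rw [LinearMap.rTensor_tmul, TensorProduct.assoc_symm_tmul, LinearMap.rTensor_tmul,
      braidLin_tmul]
    induction X.coact x with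
    | zero => simp
    | add a b ha hb => simp only [map_add, ha, hb, TensorProduct.add_tmul]
    | tmul a x => simp

open Coalgebra in
/-- The hexagon for `C (X, Y ⊗ Z)`; it holds by coassociativity of the coaction of `X`. -/
theorem braid_tensor_right (X Y Z : YD k D) :
    braid X (Y ⊗ Z) = (α_ X Y Z).inv ≫ braid X Y ▷ Z ≫ (α_ Y X Z).hom ≫
      Y ◁ braid X Z ≫ (α_ Y Z X).inv := by
  refine hom_ext (TensorProduct.ext_threefold' fun x y z => ?_)
  change ((tensorAct Y.act Z.act).toLinearMap.flip (y ⊗ₜ z)).rTensor X.carrier (X.coact x) =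
    (TensorProduct.assoc k Y.carrier Z.carrier X.carrier).symm
      ((braidLin X.coact Z.act).lTensor Y.carrier
        (TensorProduct.assoc k Y.carrier X.carrier Z.carrier
          ((Y.act.toLinearMap.flip y).rTensor X.carrier (X.coact x) ⊗ₜ z)))
  -- both sides are images of the two sides of coassociativity of the coaction of `X`
  let L : D ⊗[k] (D ⊗[k] X.carrier) →ₗ[k] (Y.carrier ⊗[k] Z.carrier) ⊗[k] X.carrier :=
    (TensorProduct.assoc k Y.carrier Z.carrier X.carrier).symm.toLinearMap ∘ₗ
      TensorProduct.map (Y.act.toLinearMap.flip y)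
        ((Z.act.toLinearMap.flip z).rTensor X.carrier)
  have h₁ (u : D ⊗[k] X.carrier) :
      ((tensorAct Y.act Z.act).toLinearMap.flip (y ⊗ₜ z)).rTensor X.carrier u =
        L (TensorProduct.assoc k D D X.carrier (Coalgebra.comul.rTensor X.carrier u)) := by
    induction u with
    | zero => simp
    | add u v hu hv => simp only [map_add, hu, hv]
    | tmul a x =>
      have := tensorAct_eq_sum Y.act Z.act a (ℛ k a)
      rw [LinearMap.rTensor_tmul, LinearMap.rTensor_tmul, ← (ℛ k a).eq]
      simp [this, L, TensorProduct.sum_tmul]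
  have h₂ (u : D ⊗[k] X.carrier) :
      (TensorProduct.assoc k Y.carrier Z.carrier X.carrier).symm
        ((braidLin X.coact Z.act).lTensor Y.carrier
          (TensorProduct.assoc k Y.carrier X.carrier Z.carrier
            ((Y.act.toLinearMap.flip y).rTensor X.carrier u ⊗ₜ z))) =
        L (X.coact.lTensor D u) := by
    induction u with
    | zero => simp
    | add u v hu hv => simp only [map_add, TensorProduct.add_tmul, hu, hv]
    | tmul a x => simp [L]
  rw [h₁, h₂, X.isCoaction.coassoc]

theorem braid_unit_left (X : YD k D) : braid (𝟙_ _) X = (λ_ X).hom ≫ (ρ_ X).inv := by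
  refine hom_ext (TensorProduct.ext' fun c x => ?_)
  change braidLin trivialCoact X.act (c ⊗ₜ x) = (TensorProduct.rid k _).symm
    (TensorProduct.lid k _ (c ⊗ₜ x))
  have h := (TensorProduct.smul_tmul (R := k) (id c : k) x (1 : k)).symm
  rw [smul_eq_mul, _root_.mul_one] at h
  simp only [braidLin_tmul, trivialCoact, TensorProduct.mk_apply, LinearMap.rTensor_tmul,
    TensorProduct.lid_tmul, TensorProduct.rid_symm_apply, LinearMap.flip_apply,
    AlgHom.toLinearMap_apply, map_one, Module.End.one_apply]
  exact h

theorem braid_unit_right (X : YD k D) : braid X (𝟙_ _) = (ρ_ X).hom ≫ (λ_ X).inv := by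
  refine hom_ext (TensorProduct.ext' fun x c => ?_)
  change braidLin X.coact trivialAct (x ⊗ₜ c) = (TensorProduct.lid k _).symm
    (TensorProduct.rid k _ (x ⊗ₜ c))
  have h (u : D ⊗[k] X.carrier) :
      ((trivialAct (k := k) (D := D)).toLinearMap.flip c).rTensor X.carrier u =
        (TensorProduct.lid k _).symm ((id c : k) •
          TensorProduct.lid k X.carrier (Coalgebra.counit.rTensor X.carrier u)) := by
    induction u with
    | zero => simp
    | add u v hu hv => simp only [map_add, smul_add, hu, hv]
    | tmul a x =>
      simp [trivialAct, smul_smul, mul_comm, TensorProduct.smul_tmul']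
  rw [braidLin_tmul, h, X.isCoaction.counit]
  simp

theorem midSwap_naturality {W W' X X' Y Y' Z Z' : YD k D} (f : W ⟶ W') (g : X ⟶ X') (h : Y ⟶ Y')
    (i : Z ⟶ Z') :
    ((f ⊗ₘ g) ⊗ₘ (h ⊗ₘ i)) ≫ midSwap W' X' Y' Z' =
      midSwap W X Y Z ≫ ((f ⊗ₘ h) ⊗ₘ (g ⊗ₘ i)) := by
  have key : (g ⊗ₘ (h ⊗ₘ i)) ≫ (α_ X' Y' Z').inv ≫ braid X' Y' ▷ Z' ≫ (α_ Y' X' Z').hom =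
      ((α_ X Y Z).inv ≫ braid X Y ▷ Z ≫ (α_ Y X Z).hom) ≫ (h ⊗ₘ (g ⊗ₘ i)) := by
    rw [associator_inv_naturality_assoc, ← tensorHom_id, ← tensorHom_id,
      tensorHom_comp_tensorHom_assoc, braid_naturality, Category.assoc, Category.assoc,
      ← associator_naturality, tensorHom_comp_tensorHom_assoc]
    simp
  rw [midSwap, midSwap, associator_naturality_assoc, ← id_tensorHom W', ← id_tensorHom W,
    tensorHom_comp_tensorHom_assoc, key, Category.assoc, Category.assoc, Category.assoc,
    Category.assoc,
    ← associator_inv_naturality, tensorHom_comp_tensorHom_assoc]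
  simp

/-- Both sides interleave `X₁ X₂ X₃` with `Y₁ Y₂ Y₃`. With naturality, this gives coassociativity of
the tensor product of two comonoids. -/
theorem associator_midSwap (X₁ X₂ X₃ Y₁ Y₂ Y₃ : YD k D) :
    midSwap (X₁ ⊗ X₂) X₃ (Y₁ ⊗ Y₂) Y₃ ≫
        (midSwap X₁ X₂ Y₁ Y₂ ▷ (X₃ ⊗ Y₃)) ≫ (α_ (X₁ ⊗ Y₁) (X₂ ⊗ Y₂) (X₃ ⊗ Y₃)).hom =
      ((α_ X₁ X₂ X₃).hom ⊗ₘ (α_ Y₁ Y₂ Y₃).hom) ≫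
        midSwap X₁ (X₂ ⊗ X₃) Y₁ (Y₂ ⊗ Y₃) ≫ ((X₁ ⊗ Y₁) ◁ midSwap X₂ X₃ Y₂ Y₃) := by
  dsimp only [midSwap]
  calc
    _ = 𝟙 _ ⊗≫ X₁ ◁ X₂ ◁ (braid X₃ Y₁) ▷ Y₂ ▷ Y₃ ⊗≫
      X₁ ◁ ((X₂ ⊗ Y₁) ◁ (braid X₃ Y₂) ≫
        (braid X₂ Y₁) ▷ (Y₂ ⊗ X₃)) ▷ Y₃ ⊗≫ 𝟙 _ := by
          rw [braid_tensor_right]; monoidal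
    _ = _ := by rw [whisker_exchange, braid_tensor_left]; monoidal

/-- The comonoid structure on the tensor product of two comonoids, for the braiding of
Yetter–Drinfeld modules. The braiding need not be invertible, so that this is not an instance of
the tensor product of comonoids in a braided category. -/
instance tensorComonObj (X Y : YD k D) [ComonObj X] [ComonObj Y] : ComonObj (X ⊗ Y) where
  comul := (Δ[X] ⊗ₘ Δ[Y]) ≫ midSwap X X Y Y
  counit := (ε[X] ⊗ₘ ε[Y]) ≫ (λ_ (𝟙_ (YD k D))).hom
  counit_comul := by
    simp only [midSwap, MonoidalCategory.tensorHom_def]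
    calc
      _ = 𝟙 _ ⊗≫ Δ[X] ▷ Y ⊗≫ (X ⊗ X) ◁ Δ[Y] ⊗≫ X ◁ braid X Y ▷ Y ⊗≫
          (ε[X] ▷ Y ≫ 𝟙_ _ ◁ ε[Y]) ▷ (X ⊗ Y) ⊗≫ 𝟙 _ := by monoidal
      _ = 𝟙 _ ⊗≫ Δ[X] ▷ Y ⊗≫ (X ⊗ X) ◁ Δ[Y] ⊗≫ X ◁ (braid X Y ≫ ε[Y] ▷ X) ▷ Y ⊗≫
          ε[X] ▷ (X ⊗ Y) ⊗≫ 𝟙 _ := by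
        rw [← whisker_exchange]; monoidal
      _ = 𝟙 _ ⊗≫ Δ[X] ▷ Y ⊗≫ (X ⊗ X) ◁ (Δ[Y] ≫ ε[Y] ▷ Y) ⊗≫
          ε[X] ▷ (X ⊗ Y) ⊗≫ 𝟙 _ := by
        rw [← braid_naturality_right, braid_unit_right]; monoidal
      _ = 𝟙 _ ⊗≫ (Δ[X] ≫ ε[X] ▷ X) ▷ Y ⊗≫ 𝟙 _ := by
        rw [counit_comul]; monoidal
      _ = _ := by rw [counit_comul]; monoidal
  comul_counit := by
    simp only [midSwap, MonoidalCategory.tensorHom_def]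
    calc
      _ = 𝟙 _ ⊗≫ Δ[X] ▷ Y ⊗≫ (X ⊗ X) ◁ Δ[Y] ⊗≫ X ◁ (braid X Y ≫ Y ◁ ε[X]) ▷ Y ⊗≫
          (X ⊗ Y) ◁ ε[Y] ⊗≫ 𝟙 _ := by monoidal
      _ = 𝟙 _ ⊗≫ Δ[X] ▷ Y ⊗≫ X ◁ (X ◁ Δ[Y] ≫ ε[X] ▷ (Y ⊗ Y)) ⊗≫
          (X ⊗ Y) ◁ ε[Y] ⊗≫ 𝟙 _ := by
        rw [← braid_naturality_left, braid_unit_left]; monoidal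
      _ = 𝟙 _ ⊗≫ (Δ[X] ≫ X ◁ ε[X]) ▷ Y ⊗≫ X ◁ (Δ[Y] ≫ Y ◁ ε[Y]) ⊗≫ 𝟙 _ := by
        rw [whisker_exchange]; monoidal
      _ = _ := by rw [comul_counit, comul_counit]; monoidal
  comul_assoc := by
    have h₁ : midSwap X X Y Y ≫ (Δ[X] ⊗ₘ Δ[Y]) ▷ (X ⊗ Y) =
        (Δ[X] ▷ X ⊗ₘ Δ[Y] ▷ Y) ≫ midSwap (X ⊗ X) X (Y ⊗ Y) Y := by
      have := midSwap_naturality Δ[X] (𝟙 X) Δ[Y] (𝟙 Y)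
      simpa using this.symm
    have h₂ : midSwap X X Y Y ≫ (X ⊗ Y) ◁ (Δ[X] ⊗ₘ Δ[Y]) =
        (X ◁ Δ[X] ⊗ₘ Y ◁ Δ[Y]) ≫ midSwap X (X ⊗ X) Y (Y ⊗ Y) := by
      have := midSwap_naturality (𝟙 X) Δ[X] (𝟙 Y) Δ[Y]
      simpa using this.symm
    simp only [MonoidalCategory.whiskerLeft_comp, comp_whiskerRight, Category.assoc]
    rw [reassoc_of% h₁, reassoc_of% h₂, associator_midSwap, tensorHom_comp_tensorHom_assoc,
      tensorHom_comp_tensorHom_assoc,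
      tensorHom_comp_tensorHom_assoc, comul_assoc, comul_assoc, Category.assoc,
      Category.assoc]

end YetterDrinfeld.YD

/-! ### Convolution and twists -/

namespace CategoryTheory.MonoidalCategory

variable {C : Type*} [Category* C] [MonoidalCategory C] {B X : C} [MonObj B] [ComonObj X]

/-- The endomorphism `b ⊗ x ↦ b f(x₁) ⊗ x₂` of `B ⊗ X`. -/
def twist (f : X ⟶ B) : B ⊗ X ⟶ B ⊗ X :=
  B ◁ Δ[X] ≫ (α_ B X X).inv ≫ (B ◁ f ≫ μ[B]) ▷ X

/-- The morphism `x ↦ (B ⊗ ε) F (1 ⊗ x)`. -/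
def untwist (F : B ⊗ X ⟶ B ⊗ X) : X ⟶ B :=
  (λ_ X).inv ≫ η[B] ▷ X ≫ F ≫ B ◁ ε[X] ≫ (ρ_ B).hom

theorem twist_one : twist (ε[X] ≫ η[B]) = 𝟙 (B ⊗ X) := by
  simp only [twist, comp_whiskerRight, MonoidalCategory.whiskerLeft_comp, Category.assoc]
  calc
    _ = B ◁ (Δ[X] ≫ ε[X] ▷ X) ⊗≫ (B ◁ η[B] ≫ μ[B]) ▷ X := by monoidal
    _ = _ := by rw [counit_comul, MonObj.mul_one]; monoidal

theorem one_twist (f : X ⟶ B) :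
    (λ_ X).inv ≫ η[B] ▷ X ≫ twist f = Δ[X] ≫ f ▷ X := by
  simp only [twist]
  calc
    _ = 𝟙 _ ⊗≫ (η[B] ▷ X ≫ B ◁ (Δ[X] ≫ f ▷ X)) ⊗≫ μ[B] ▷ X := by monoidal
    _ = 𝟙 _ ⊗≫ Δ[X] ⊗≫ f ▷ X ⊗≫ (η[B] ▷ B ≫ μ[B]) ▷ X := by
      rw [← whisker_exchange]; monoidal
    _ = _ := by rw [MonObj.one_mul]; monoidal

theorem twist_counit (f : X ⟶ B) :
    twist f ≫ B ◁ ε[X] ≫ (ρ_ B).hom = B ◁ f ≫ μ[B] := by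
  simp only [twist]
  calc
    _ = 𝟙 _ ⊗≫ B ◁ Δ[X] ⊗≫ ((B ◁ f ≫ μ[B]) ▷ X ≫ B ◁ ε[X]) ⊗≫ 𝟙 _ := by monoidal
    _ = 𝟙 _ ⊗≫ B ◁ (Δ[X] ≫ X ◁ ε[X]) ⊗≫ B ◁ f ≫ μ[B] := by
      rw [← whisker_exchange]; monoidal
    _ = _ := by rw [comul_counit]; monoidal

theorem untwist_twist_comp_twist (f g : X ⟶ B) :
    untwist (twist f ≫ twist g) = Δ[X] ≫ (f ⊗ₘ g) ≫ μ[B] := by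
  rw [untwist, Category.assoc, twist_counit, reassoc_of% one_twist, tensorHom_def, Category.assoc]

theorem untwist_twist (f : X ⟶ B) : untwist (twist f) = f := by
  rw [untwist, twist_counit]
  calc
    _ = 𝟙 _ ⊗≫ (η[B] ▷ X ≫ B ◁ f) ≫ μ[B] := by monoidal
    _ = 𝟙 _ ⊗≫ f ⊗≫ η[B] ▷ B ≫ μ[B] := by rw [← whisker_exchange]; monoidal
    _ = _ := by rw [MonObj.one_mul]; monoidal

theorem twist_injective : Function.Injective (twist : (X ⟶ B) → (B ⊗ X ⟶ B ⊗ X)) :=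
  Function.LeftInverse.injective untwist_twist

/-- The coaction `B ⊗ Δ` of `X` on `B ⊗ X`. -/
def freeCoact (B X : C) [ComonObj X] : B ⊗ X ⟶ (B ⊗ X) ⊗ X := B ◁ Δ[X] ≫ (α_ B X X).inv

/-- The action `μ ⊗ X` of `B` on `B ⊗ X`. -/
def freeAct (B X : C) [MonObj B] : B ⊗ (B ⊗ X) ⟶ B ⊗ X := (α_ B B X).inv ≫ μ[B] ▷ X

theorem twist_colinear (f : X ⟶ B) :
    twist f ≫ freeCoact B X = freeCoact B X ≫ twist f ▷ X := by
  simp only [twist, freeCoact]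
  calc
    _ = 𝟙 _ ⊗≫ B ◁ Δ[X] ⊗≫ ((B ◁ f ≫ μ[B]) ▷ X ≫ B ◁ Δ[X]) ⊗≫ 𝟙 _ := by monoidal
    _ = 𝟙 _ ⊗≫ B ◁ (Δ[X] ≫ X ◁ Δ[X]) ⊗≫ ((B ◁ f ≫ μ[B]) ▷ (X ⊗ X)) ⊗≫ 𝟙 _ := by
      rw [← whisker_exchange]; monoidal
    _ = _ := by rw [comul_assoc]; monoidal

theorem twist_linear (f : X ⟶ B) :
    freeAct B X ≫ twist f = B ◁ twist f ≫ freeAct B X := by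
  simp only [twist, freeAct]
  calc
    _ = 𝟙 _ ⊗≫ (μ[B] ▷ X ≫ B ◁ (Δ[X] ≫ f ▷ X)) ⊗≫ μ[B] ▷ X ⊗≫ 𝟙 _ := by monoidal
    _ = 𝟙 _ ⊗≫ (B ⊗ B) ◁ (Δ[X] ≫ f ▷ X) ⊗≫ (μ[B] ▷ B ≫ μ[B]) ▷ X ⊗≫ 𝟙 _ := by
      rw [← whisker_exchange]; monoidal
    _ = _ := by rw [MonObj.mul_assoc]; monoidal

/-- A `B`-linear and `X`-colinear endomorphism of `B ⊗ X` is a twist. -/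
theorem eq_twist {F : B ⊗ X ⟶ B ⊗ X} (hl : freeAct B X ≫ F = B ◁ F ≫ freeAct B X)
    (hr : F ≫ freeCoact B X = freeCoact B X ≫ F ▷ X) : F = twist (untwist F) := by
  have h : F ≫ B ◁ ε[X] ≫ (ρ_ B).hom = B ◁ untwist F ≫ μ[B] := by
    calc
      _ = 𝟙 _ ⊗≫ (B ◁ η[B] ≫ μ[B]) ▷ X ⊗≫ F ≫ B ◁ ε[X] ≫ (ρ_ B).hom := by
        rw [MonObj.mul_one]; monoidal
      _ = 𝟙 _ ⊗≫ B ◁ η[B] ▷ X ≫ (freeAct B X ≫ F) ≫ B ◁ ε[X] ≫ (ρ_ B).hom := by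
        simp only [freeAct]; monoidal
      _ = 𝟙 _ ⊗≫ B ◁ (η[B] ▷ X ≫ F) ⊗≫ (μ[B] ▷ X ≫ B ◁ ε[X]) ≫ (ρ_ B).hom := by
        rw [hl]; simp only [freeAct]; monoidal
      _ = _ := by
        rw [← whisker_exchange]; simp only [untwist]; monoidal
  calc
    F = (F ≫ B ◁ (Δ[X] ≫ ε[X] ▷ X)) ⊗≫ 𝟙 _ := by rw [counit_comul]; monoidal
    _ = (F ≫ freeCoact B X) ≫ (B ◁ ε[X] ≫ (ρ_ B).hom) ▷ X := by simp only [freeCoact]; monoidal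
    _ = freeCoact B X ≫ (F ≫ B ◁ ε[X] ≫ (ρ_ B).hom) ▷ X := by rw [hr]; simp
    _ = _ := by rw [h]; simp [freeCoact, twist]

/-- Composition of twists is convolution: a composite of linear and colinear maps is a twist by
`eq_twist`, and `untwist_twist_comp_twist` tells by what. -/
theorem twist_comp_twist (f g : X ⟶ B) :
    twist f ≫ twist g = twist (Δ[X] ≫ (f ⊗ₘ g) ≫ μ[B]) := by
  rw [← untwist_twist_comp_twist]
  apply eq_twist
  · rw [← Category.assoc, twist_linear, Category.assoc, twist_linear]; simp
  · rw [Category.assoc, twist_colinear, ← Category.assoc, twist_colinear]; simp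

/-- A morphism from a comonoid to a monoid is invertible for the convolution product if and only
if its twist is an isomorphism. -/
theorem isIso_twist_iff (f : X ⟶ B) : IsIso (twist f) ↔
    ∃ g : X ⟶ B, Δ[X] ≫ (f ⊗ₘ g) ≫ μ[B] = ε[X] ≫ η[B] ∧
      Δ[X] ≫ (g ⊗ₘ f) ≫ μ[B] = ε[X] ≫ η[B] := by
  refine ⟨fun h => ⟨untwist (inv (twist f)), ?_⟩, fun ⟨g, h₁, h₂⟩ => ⟨twist g, ?_⟩⟩
  · have hinv : inv (twist f) = twist (untwist (inv (twist f))) := by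
      apply eq_twist
      · rw [IsIso.comp_inv_eq, Category.assoc, twist_linear, ← Category.assoc,
          ← MonoidalCategory.whiskerLeft_comp]
        simp
      · rw [IsIso.inv_comp_eq, ← Category.assoc, twist_colinear, Category.assoc,
          ← comp_whiskerRight]
        simp
    constructor
    all_goals
      apply twist_injective
      rw [← twist_comp_twist, ← hinv, twist_one]
      simp
  · rw [twist_comp_twist, twist_comp_twist, h₁, h₂, twist_one]
    exact ⟨rfl, rfl⟩

end CategoryTheory.MonoidalCategory

/-! ### Products of morphisms and commutation rules in crossed products -/

namespace CategoryTheory.MonoidalCategory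

variable {C : Type*} [Category* C] [MonoidalCategory C] {A B X X' Y Y' Z : C} [MonObj A] [MonObj B]

/-- The product `x ⊗ y ↦ f(x) g(y)` of two morphisms to a monoid. -/
def mulHom (f : X ⟶ A) (g : Y ⟶ A) : X ⊗ Y ⟶ A := (f ⊗ₘ g) ≫ μ[A]

theorem whiskerRight_mulHom (x : X' ⟶ X) (f : X ⟶ A) (g : Y ⟶ A) :
    x ▷ Y ≫ mulHom f g = mulHom (x ≫ f) g := by
  simp [mulHom, MonoidalCategory.tensorHom_def]

theorem whiskerLeft_mulHom (y : Y' ⟶ Y) (f : X ⟶ A) (g : Y ⟶ A) :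
    X ◁ y ≫ mulHom f g = mulHom f (y ≫ g) := by
  simp [mulHom, tensorHom_def']

theorem mulHom_assoc (f : X ⟶ A) (g : Y ⟶ A) (h : Z ⟶ A) :
    mulHom (mulHom f g) h = (α_ X Y Z).hom ≫ mulHom f (mulHom g h) := by
  simp only [mulHom, MonoidalCategory.tensorHom_def]
  calc
    _ = 𝟙 _ ⊗≫ f ▷ Y ▷ Z ⊗≫ A ◁ g ▷ Z ⊗≫ (μ[A] ▷ Z ≫ A ◁ h) ≫ μ[A] := by monoidal
    _ = 𝟙 _ ⊗≫ f ▷ Y ▷ Z ⊗≫ A ◁ g ▷ Z ⊗≫ (A ⊗ A) ◁ h ≫ μ[A] ▷ A ≫ μ[A] := by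
      rw [← whisker_exchange]; monoidal
    _ = _ := by rw [MonObj.mul_assoc]; monoidal

theorem mulHom_one (f : X ⟶ A) : mulHom f η[A] = (ρ_ X).hom ≫ f := by
  rw [mulHom, MonoidalCategory.tensorHom_def, Category.assoc, MonObj.mul_one,
    rightUnitor_naturality]

theorem one_mulHom (f : X ⟶ A) : mulHom η[A] f = (λ_ X).hom ≫ f := by
  rw [mulHom, tensorHom_def', Category.assoc, MonObj.one_mul, leftUnitor_naturality]

theorem mulHom_comp (p : B ⟶ A) [IsMonHom p] (f : X ⟶ B) (g : Y ⟶ B) :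
    mulHom f g ≫ p = mulHom (f ≫ p) (g ≫ p) := by
  simp [mulHom]

theorem mulHom_id_id : mulHom (𝟙 A) (𝟙 A) = μ[A] := by simp [mulHom]

/-- Left multiplication by `p(B)` acts on products `p(b) c(x)` through the first factor. -/
theorem mulHom_mulHom_left (p : B ⟶ A) [IsMonHom p] (c : X ⟶ A) (y : Y ⟶ B ⊗ X) :
    mulHom p (y ≫ mulHom p c) = B ◁ y ≫ freeAct B X ≫ mulHom p c := by
  have h : (α_ B B X).hom ≫ mulHom p (mulHom p c) = μ[B] ▷ X ≫ mulHom p c := by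
    rw [← mulHom_assoc, whiskerRight_mulHom, ← mulHom_id_id, mulHom_comp, Category.id_comp]
  rw [freeAct, Category.assoc, ← h, Iso.inv_hom_id_assoc, whiskerLeft_mulHom]

end CategoryTheory.MonoidalCategory

namespace YetterDrinfeld.YD

variable {k D : Type u} [Field k] [Ring D] [HopfAlgebra k D]
variable {H B A : YD k D} [BraidedHopf H]

theorem comulTensor_eq {X Y : YD k D} (f : H ⊗ H ⟶ X) (f' : H ⊗ H ⟶ Y) :
    comulTensor f f' = Δ[H ⊗ H] ≫ (f ⊗ₘ f') :=
  (Category.assoc _ _ _).symm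

/-- The morphism `h ⊗ b ↦ h₁ · b' ⊗ h₂'`, where the braiding sends `h₂ ⊗ b` to `b' ⊗ h₂'`. -/
def actSwap (act : H ⊗ B ⟶ B) : H ⊗ B ⟶ B ⊗ H :=
  Δ[H] ▷ B ≫ (α_ H H B).hom ≫ H ◁ braid H B ≫ (α_ H B H).inv ≫ act ▷ H

theorem actSwap_counit (act : H ⊗ B ⟶ B) : actSwap act ≫ B ◁ ε[H] ≫ (ρ_ B).hom = act := by
  simp only [actSwap]
  calc
    _ = 𝟙 _ ⊗≫ Δ[H] ▷ B ⊗≫ H ◁ braid H B ⊗≫ (act ▷ H ≫ B ◁ ε[H]) ⊗≫ 𝟙 _ := by monoidal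
    _ = 𝟙 _ ⊗≫ Δ[H] ▷ B ⊗≫ H ◁ (braid H B ≫ B ◁ ε[H]) ⊗≫ act := by
      rw [← whisker_exchange]; monoidal
    _ = 𝟙 _ ⊗≫ (Δ[H] ≫ H ◁ ε[H]) ▷ B ⊗≫ act := by
      rw [← braid_naturality_left, braid_unit_left]; monoidal
    _ = _ := by rw [comul_counit]; monoidal

theorem comulTensor_counit (σ : H ⊗ H ⟶ B) :
    comulTensor σ μ[H] ≫ B ◁ ε[H] ≫ (ρ_ B).hom = σ := by
  have h : μ[H] ≫ ε[H] = ε[H ⊗ H] := BraidedHopf.mul_counit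
  rw [comulTensor_eq, tensorHom_def', Category.assoc, Category.assoc, whisker_exchange_assoc,
    ← MonoidalCategory.whiskerLeft_comp_assoc, h]
  calc
    _ = (Δ[H ⊗ H] ≫ (H ⊗ H) ◁ ε[H ⊗ H]) ⊗≫ σ := by
      rw [← whisker_exchange_assoc]; monoidal
    _ = _ := by rw [comul_counit]; monoidal

variable [MonObj B]

theorem crossedMul_eq (act : H ⊗ B ⟶ B) (σ : H ⊗ H ⟶ B) :
    crossedMul act σ = (α_ B H (B ⊗ H)).hom ≫ B ◁ ((α_ H B H).inv ≫ actSwap act ▷ H ≫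
      (α_ B H H).hom ≫ B ◁ comulTensor σ μ[H] ≫ freeAct B H) ≫ freeAct B H := by
  simp only [crossedMul, actSwap, midSwap, MonoidalCategory.tensorHom_def, freeAct]
  calc
    _ = 𝟙 _ ⊗≫ B ◁ Δ[H] ▷ (B ⊗ H) ⊗≫ B ◁ H ◁ braid H B ▷ H ⊗≫ B ◁ act ▷ (H ⊗ H) ⊗≫
      ((B ⊗ B) ◁ comulTensor σ μ[H] ≫ μ[B] ▷ (B ⊗ H)) ⊗≫ μ[B] ▷ H := by monoidal
    _ = 𝟙 _ ⊗≫ B ◁ Δ[H] ▷ (B ⊗ H) ⊗≫ B ◁ H ◁ braid H B ▷ H ⊗≫ B ◁ act ▷ (H ⊗ H) ⊗≫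
      ((B ⊗ B) ◁ comulTensor σ μ[H]) ⊗≫ (μ[B] ▷ B ≫ μ[B]) ▷ H := by monoidal
    _ = _ := by rw [MonObj.mul_assoc]; monoidal

variable [MonObj A]

/-- `p : B ⟶ A` and `j : H ⟶ A` satisfy the commutation rules of `b ↦ b # 1` and `h ↦ 1 # h` in
a crossed product: `j(h) p(b) = p(h₁ · b') j(h₂')` and
`j(h) j(g) = p(σ(h₁, g₁')) j(h₂' g₂)`. -/
structure IsCrossedPair (act : H ⊗ B ⟶ B) (σ : H ⊗ H ⟶ B) (p : B ⟶ A) (j : H ⟶ A) : Prop where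
  isMonHom : IsMonHom p
  one : η[H] ≫ j = η[A]
  act_comm : mulHom j p = actSwap act ≫ mulHom p j
  mul_comm : mulHom j j = comulTensor σ μ[H] ≫ mulHom p j

namespace IsCrossedPair

variable {act : H ⊗ B ⟶ B} {σ : H ⊗ H ⟶ B} {p : B ⟶ A} {j : H ⟶ A}

theorem crossedMul_comp (h : IsCrossedPair act σ p j) :
    crossedMul act σ ≫ mulHom p j = mulHom (mulHom p j) (mulHom p j) := by
  have := h.isMonHom
  have h₁ : mulHom j (mulHom p j) = ((α_ H B H).inv ≫ actSwap act ▷ H ≫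
      (α_ B H H).hom ≫ B ◁ comulTensor σ μ[H] ≫ freeAct B H) ≫ mulHom p j := by
    simp only [Category.assoc]
    rw [← mulHom_mulHom_left, ← h.mul_comm, ← mulHom_assoc, whiskerRight_mulHom, ← h.act_comm,
      mulHom_assoc, Iso.inv_hom_id_assoc]
  rw [crossedMul_eq, mulHom_assoc, h₁, mulHom_mulHom_left, Category.assoc, Category.assoc]

theorem crossedOne_comp (h : IsCrossedPair act σ p j) : crossedOne B H ≫ mulHom p j = η[A] := by
  have := h.isMonHom
  rw [crossedOne, MonoidalCategory.tensorHom_def, Category.assoc, Category.assoc,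
    whiskerLeft_mulHom, h.one, whiskerRight_mulHom, IsMonHom.one_hom, mulHom_one]
  monoidal

end IsCrossedPair

end YetterDrinfeld.YD

/-! ### Colinearity of the crossed product -/

namespace YetterDrinfeld.YD

variable {k D : Type u} [Field k] [Ring D] [HopfAlgebra k D]
variable {H B A : YD k D} [BraidedHopf H]

/-- `actSwap act` is colinear: `h₁ · b' ⊗ h₂' ⊗ h₃'` is computed in two ways. -/
theorem actSwap_comul (act : H ⊗ B ⟶ B) : actSwap act ≫ freeCoact B H =
    Δ[H] ▷ B ≫ (α_ H H B).hom ≫ H ◁ braid H B ≫ (α_ H B H).inv ≫ actSwap act ▷ H := by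
  simp only [actSwap, freeCoact]
  calc
    _ = 𝟙 _ ⊗≫ Δ[H] ▷ B ⊗≫ H ◁ braid H B ⊗≫ (act ▷ H ≫ B ◁ Δ[H]) ⊗≫ 𝟙 _ := by monoidal
    _ = 𝟙 _ ⊗≫ Δ[H] ▷ B ⊗≫ H ◁ (braid H B ≫ B ◁ Δ[H]) ⊗≫ act ▷ (H ⊗ H) ⊗≫ 𝟙 _ := by
      rw [← whisker_exchange]; monoidal
    _ = 𝟙 _ ⊗≫ (Δ[H] ≫ H ◁ Δ[H]) ▷ B ⊗≫ H ◁ (H ◁ braid H B ⊗≫ braid H B ▷ H) ⊗≫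
        act ▷ (H ⊗ H) ⊗≫ 𝟙 _ := by
      rw [← braid_naturality_left, braid_tensor_left]; monoidal
    _ = 𝟙 _ ⊗≫ Δ[H] ▷ B ⊗≫ (Δ[H] ▷ (H ⊗ B) ≫ (H ⊗ H) ◁ braid H B) ⊗≫ H ◁ braid H B ▷ H ⊗≫
        act ▷ (H ⊗ H) ⊗≫ 𝟙 _ := by
      rw [comul_assoc]; monoidal
    _ = _ := by
      rw [← whisker_exchange]; monoidal

/-- `h ⊗ g ↦ σ(h₁, g₁') ⊗ h₂' g₂` is colinear, as `H ⊗ H` is a comonoid and `μ` is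
comultiplicative. -/
theorem comulTensor_comul (σ : H ⊗ H ⟶ B) : comulTensor σ μ[H] ≫ freeCoact B H =
    (Δ[H] ⊗ₘ Δ[H]) ≫ midSwap H H H H ≫ (comulTensor σ μ[H] ⊗ₘ μ[H]) := by
  have h : μ[H] ≫ Δ[H] = Δ[H ⊗ H] ≫ (μ[H] ⊗ₘ μ[H]) :=
    BraidedHopf.mul_comul.trans (Category.assoc _ _ _).symm
  rw [← Category.assoc]
  change _ = Δ[H ⊗ H] ≫ _
  calc
    _ = Δ[H ⊗ H] ≫ (σ ⊗ₘ (μ[H] ≫ Δ[H])) ≫ (α_ B H H).inv := by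
      rw [comulTensor_eq, freeCoact, ← id_tensorHom, Category.assoc,
        tensorHom_comp_tensorHom_assoc, Category.comp_id]
    _ = (Δ[H ⊗ H] ≫ (H ⊗ H) ◁ Δ[H ⊗ H]) ≫ (σ ⊗ₘ (μ[H] ⊗ₘ μ[H])) ≫ (α_ B H H).inv := by
      rw [h, ← id_tensorHom, Category.assoc, tensorHom_comp_tensorHom_assoc, Category.id_comp]
    _ = _ := by
      rw [comul_assoc, comulTensor_eq, associator_inv_naturality, ← tensorHom_id, Category.assoc,
        Category.assoc, Iso.hom_inv_id_assoc, tensorHom_comp_tensorHom, Category.id_comp]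

variable [MonObj B]

/-- The coaction `B ⊗ Δ` on a crossed product is multiplicative. -/
theorem crossedMul_comul (act : H ⊗ B ⟶ B) (σ : H ⊗ H ⟶ B) :
    crossedMul act σ ≫ freeCoact B H = (freeCoact B H ⊗ₘ freeCoact B H) ≫
      midSwap (B ⊗ H) H (B ⊗ H) H ≫ (crossedMul act σ ⊗ₘ μ[H]) := by
  have h₁ := actSwap_comul act
  have h₂ := comulTensor_comul σ
  rw [crossedMul_eq]
  simp only [freeAct, freeCoact, midSwap, MonoidalCategory.tensorHom_def] at h₁ h₂ ⊢
  generalize comulTensor σ μ[H] = c at h₁ h₂ ⊢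
  generalize actSwap act = s at h₁ h₂ ⊢
  calc
    _ = 𝟙 _ ⊗≫ B ◁ s ▷ H ⊗≫ (B ⊗ B) ◁ c ⊗≫ B ◁ μ[B] ▷ H ⊗≫ (μ[B] ▷ H ≫ B ◁ Δ[H]) ⊗≫ 𝟙 _ := by
      monoidal
    _ = 𝟙 _ ⊗≫ B ◁ s ▷ H ⊗≫ (B ⊗ B) ◁ c ⊗≫ B ◁ μ[B] ▷ H ⊗≫ B ◁ B ◁ Δ[H] ⊗≫
        μ[B] ▷ (H ⊗ H) ⊗≫ 𝟙 _ := by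
      rw [← whisker_exchange]; monoidal
    _ = 𝟙 _ ⊗≫ B ◁ s ▷ H ⊗≫ (B ⊗ B) ◁ c ⊗≫ B ◁ (μ[B] ▷ H ≫ B ◁ Δ[H]) ⊗≫
        μ[B] ▷ (H ⊗ H) ⊗≫ 𝟙 _ := by
      monoidal
    _ = 𝟙 _ ⊗≫ B ◁ s ▷ H ⊗≫ (B ⊗ B) ◁ (c ≫ B ◁ Δ[H] ≫ (α_ B H H).inv) ⊗≫
        B ◁ μ[B] ▷ (H ⊗ H) ⊗≫ μ[B] ▷ (H ⊗ H) ⊗≫ 𝟙 _ := by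
      rw [← whisker_exchange]; monoidal
    _ = 𝟙 _ ⊗≫ B ◁ s ▷ H ⊗≫ B ◁ B ◁ Δ[H] ▷ H ⊗≫ (B ⊗ B) ◁ (H ⊗ H) ◁ Δ[H] ⊗≫
        (B ⊗ B) ◁ H ◁ braid H H ▷ H ⊗≫ (B ⊗ B) ◁ c ▷ (H ⊗ H) ⊗≫ (B ⊗ B) ◁ (B ⊗ H) ◁ μ[H] ⊗≫
        B ◁ μ[B] ▷ (H ⊗ H) ⊗≫ μ[B] ▷ (H ⊗ H) ⊗≫ 𝟙 _ := by
      rw [h₂]; monoidal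
    _ = 𝟙 _ ⊗≫ B ◁ (s ≫ B ◁ Δ[H] ≫ (α_ B H H).inv) ▷ H ⊗≫ (B ⊗ B) ◁ (H ⊗ H) ◁ Δ[H] ⊗≫
        (B ⊗ B) ◁ H ◁ braid H H ▷ H ⊗≫ (B ⊗ B) ◁ c ▷ (H ⊗ H) ⊗≫ (B ⊗ B) ◁ (B ⊗ H) ◁ μ[H] ⊗≫
        B ◁ μ[B] ▷ (H ⊗ H) ⊗≫ μ[B] ▷ (H ⊗ H) ⊗≫ 𝟙 _ := by
      monoidal
    _ = 𝟙 _ ⊗≫ B ◁ Δ[H] ▷ (B ⊗ H) ⊗≫ B ◁ H ◁ braid H B ▷ H ⊗≫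
        B ◁ ((s ▷ H) ▷ H ≫ ((B ⊗ H) ⊗ H) ◁ Δ[H]) ⊗≫
        (B ⊗ B) ◁ H ◁ braid H H ▷ H ⊗≫ (B ⊗ B) ◁ c ▷ (H ⊗ H) ⊗≫ (B ⊗ B) ◁ (B ⊗ H) ◁ μ[H] ⊗≫
        B ◁ μ[B] ▷ (H ⊗ H) ⊗≫ μ[B] ▷ (H ⊗ H) ⊗≫ 𝟙 _ := by
      rw [h₁]; monoidal
    _ = 𝟙 _ ⊗≫ B ◁ Δ[H] ▷ (B ⊗ H) ⊗≫ B ◁ H ◁ (braid H B ▷ H ≫ (B ⊗ H) ◁ Δ[H]) ⊗≫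
        B ◁ s ▷ H ▷ H ▷ H ⊗≫ (B ⊗ B) ◁ H ◁ braid H H ▷ H ⊗≫
        (B ⊗ B) ◁ c ▷ (H ⊗ H) ⊗≫ (B ⊗ B) ◁ (B ⊗ H) ◁ μ[H] ⊗≫
        B ◁ μ[B] ▷ (H ⊗ H) ⊗≫ μ[B] ▷ (H ⊗ H) ⊗≫ 𝟙 _ := by
      rw [← whisker_exchange]; monoidal
    _ = 𝟙 _ ⊗≫ B ◁ Δ[H] ▷ (B ⊗ H) ⊗≫ B ◁ H ◁ (H ⊗ B) ◁ Δ[H] ⊗≫ B ◁ H ◁ braid H B ▷ (H ⊗ H) ⊗≫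
        B ◁ (s ▷ (H ⊗ H) ≫ (B ⊗ H) ◁ braid H H) ▷ H ⊗≫
        (B ⊗ B) ◁ c ▷ (H ⊗ H) ⊗≫ (B ⊗ B) ◁ (B ⊗ H) ◁ μ[H] ⊗≫
        B ◁ μ[B] ▷ (H ⊗ H) ⊗≫ μ[B] ▷ (H ⊗ H) ⊗≫ 𝟙 _ := by
      rw [← whisker_exchange]; monoidal
    _ = 𝟙 _ ⊗≫ B ◁ Δ[H] ▷ (B ⊗ H) ⊗≫ B ◁ H ◁ (H ⊗ B) ◁ Δ[H] ⊗≫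
        B ◁ H ◁ braid H (B ⊗ H) ▷ H ⊗≫ B ◁ s ▷ H ▷ H ▷ H ⊗≫
        (B ⊗ B) ◁ c ▷ (H ⊗ H) ⊗≫
        B ◁ ((B ⊗ (B ⊗ H)) ◁ μ[H] ≫ ((α_ B B H).inv ≫ μ[B] ▷ H) ▷ H) ⊗≫
        μ[B] ▷ (H ⊗ H) ⊗≫ 𝟙 _ := by
      rw [← whisker_exchange, braid_tensor_right]; monoidal
    _ = 𝟙 _ ⊗≫ B ◁ Δ[H] ▷ (B ⊗ H) ⊗≫ B ◁ H ◁ (H ⊗ B) ◁ Δ[H] ⊗≫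
        B ◁ H ◁ braid H (B ⊗ H) ▷ H ⊗≫ B ◁ s ▷ H ▷ H ▷ H ⊗≫
        (B ⊗ B) ◁ c ▷ (H ⊗ H) ⊗≫ B ◁ μ[B] ▷ H ▷ (H ⊗ H) ⊗≫ B ◁ (B ⊗ H) ◁ μ[H] ⊗≫
        μ[B] ▷ (H ⊗ H) ⊗≫ 𝟙 _ := by
      rw [whisker_exchange]; monoidal
    _ = 𝟙 _ ⊗≫ B ◁ Δ[H] ▷ (B ⊗ H) ⊗≫ B ◁ H ◁ (H ⊗ B) ◁ Δ[H] ⊗≫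
        B ◁ H ◁ braid H (B ⊗ H) ▷ H ⊗≫ B ◁ s ▷ H ▷ H ▷ H ⊗≫
        (B ⊗ B) ◁ c ▷ (H ⊗ H) ⊗≫ B ◁ μ[B] ▷ H ▷ (H ⊗ H) ⊗≫
        ((B ⊗ (B ⊗ H)) ◁ μ[H] ≫ ((α_ B B H).inv ≫ μ[B] ▷ H) ▷ H) := by
      monoidal
    _ = _ := by
      rw [whisker_exchange]; monoidal

end YetterDrinfeld.YD

/-! ### Crossed products and crossed pairs -/

namespace CategoryTheory.MonoidalCategory

variable {C : Type*} [Category* C] [MonoidalCategory C] {A B X Y : C} [MonObj A] [MonObj B]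

/-- The morphism `b ↦ b ⊗ 1`. -/
def inclLeft (B X : C) [MonObj X] : B ⟶ B ⊗ X := (ρ_ B).inv ≫ B ◁ η[X]

/-- The morphism `x ↦ 1 ⊗ x`. -/
def inclRight (B X : C) [MonObj B] : X ⟶ B ⊗ X := (λ_ X).inv ≫ η[B] ▷ X

/-- The morphism `b ⊗ x ↦ b ε(x)`. -/
def projLeft (B X : C) [ComonObj X] : B ⊗ X ⟶ B := B ◁ ε[X] ≫ (ρ_ B).hom

theorem freeAct_projLeft [ComonObj X] :
    freeAct B X ≫ projLeft B X = B ◁ projLeft B X ≫ μ[B] := by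
  simp only [freeAct, projLeft]
  calc
    _ = 𝟙 _ ⊗≫ (μ[B] ▷ X ≫ B ◁ ε[X]) ⊗≫ 𝟙 _ := by monoidal
    _ = _ := by rw [← whisker_exchange]; monoidal

theorem inclRight_projLeft [ComonObj X] : inclRight B X ≫ projLeft B X = ε[X] ≫ η[B] := by
  simp only [inclRight, projLeft]
  calc
    _ = 𝟙 _ ⊗≫ (η[B] ▷ X ≫ B ◁ ε[X]) ⊗≫ 𝟙 _ := by monoidal
    _ = _ := by rw [← whisker_exchange]; monoidal

theorem inclRight_freeAct : B ◁ inclRight B X ≫ freeAct B X = 𝟙 _ := by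
  simp only [inclRight, freeAct]
  calc
    _ = 𝟙 _ ⊗≫ (B ◁ η[B] ≫ μ[B]) ▷ X := by monoidal
    _ = _ := by rw [MonObj.mul_one]; monoidal

theorem inclLeft_freeAct [MonObj X] : B ◁ inclLeft B X ≫ freeAct B X = μ[B] ≫ inclLeft B X := by
  simp only [inclLeft, freeAct]
  calc
    _ = 𝟙 _ ⊗≫ ((B ⊗ B) ◁ η[X] ≫ μ[B] ▷ X) := by monoidal
    _ = _ := by rw [whisker_exchange]; monoidal

theorem one_freeAct (f : Y ⟶ B ⊗ X) : (inclRight B Y ≫ B ◁ f) ≫ freeAct B X = f := by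
  simp only [inclRight, freeAct]
  calc
    _ = 𝟙 _ ⊗≫ (η[B] ▷ Y ≫ B ◁ f) ⊗≫ μ[B] ▷ X := by monoidal
    _ = f ⊗≫ (η[B] ▷ B ≫ μ[B]) ▷ X := by rw [← whisker_exchange]; monoidal
    _ = _ := by rw [MonObj.one_mul]; monoidal

theorem inclRight_mulHom (p : B ⟶ A) [IsMonHom p] (j : X ⟶ A) : inclRight B X ≫ mulHom p j = j := by
  rw [inclRight, Category.assoc, whiskerRight_mulHom, IsMonHom.one_hom, one_mulHom,
    Iso.inv_hom_id_assoc]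

theorem mulHom_inv_projLeft [ComonObj X] (p : B ⟶ A) [IsMonHom p] {j : X ⟶ A} {e : B ⊗ X ≅ A}
    (he : e.hom = mulHom p j) (f : Y ⟶ A) :
    mulHom p f ≫ e.inv ≫ projLeft B X = B ◁ (f ≫ e.inv ≫ projLeft B X) ≫ μ[B] := by
  have h := mulHom_mulHom_left p j (f ≫ e.inv)
  rw [← he, Category.assoc, e.inv_hom_id, Category.comp_id] at h
  rw [h, Category.assoc, Category.assoc, e.hom_inv_id_assoc, freeAct_projLeft]
  simp

end CategoryTheory.MonoidalCategory

namespace YetterDrinfeld.YD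

variable {k D : Type u} [Field k] [Ring D] [HopfAlgebra k D]
variable {H B A : YD k D} [BraidedHopf H] [MonObj B]

theorem IsTwoCocycle.comulTensor_one {act : H ⊗ B ⟶ B} {σ : H ⊗ H ⟶ B} (h : IsTwoCocycle act σ) :
    H ◁ η[H] ≫ comulTensor σ μ[H] = (ρ_ H).hom ≫ inclRight B H := by
  have h₁ := BraidedHopf.one_comul (H := H)
  simp only [comulTensor, midSwap, MonoidalCategory.tensorHom_def, inclRight] at h₁ ⊢
  calc
    _ = 𝟙 _ ⊗≫ (H ◁ η[H] ≫ Δ[H] ▷ H) ⊗≫ (H ⊗ H) ◁ Δ[H] ⊗≫ H ◁ braid H H ▷ H ⊗≫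
        σ ▷ (H ⊗ H) ≫ B ◁ μ[H] := by monoidal
    _ = 𝟙 _ ⊗≫ Δ[H] ⊗≫ (H ⊗ H) ◁ (η[H] ≫ Δ[H]) ⊗≫ H ◁ braid H H ▷ H ⊗≫
        σ ▷ (H ⊗ H) ≫ B ◁ μ[H] := by rw [whisker_exchange]; monoidal
    _ = 𝟙 _ ⊗≫ Δ[H] ⊗≫ H ◁ ((H ◁ η[H]) ▷ 𝟙_ (YD k D) ≫ (H ⊗ H) ◁ η[H]) ⊗≫ H ◁ braid H H ▷ H ⊗≫
        σ ▷ (H ⊗ H) ≫ B ◁ μ[H] := by rw [h₁]; monoidal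
    _ = 𝟙 _ ⊗≫ Δ[H] ⊗≫ H ◁ (H ⊗ 𝟙_ (YD k D)) ◁ η[H] ⊗≫ H ◁ (H ◁ η[H] ≫ braid H H) ▷ H ⊗≫
        σ ▷ (H ⊗ H) ≫ B ◁ μ[H] := by rw [← whisker_exchange]; monoidal
    _ = 𝟙 _ ⊗≫ Δ[H] ⊗≫ ((H ⊗ 𝟙_ (YD k D)) ◁ (H ◁ η[H]) ≫ (H ◁ η[H]) ▷ (H ⊗ H)) ⊗≫
        σ ▷ (H ⊗ H) ≫ B ◁ μ[H] := by rw [braid_naturality_right, braid_unit_right]; monoidal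
    _ = 𝟙 _ ⊗≫ Δ[H] ⊗≫ H ◁ η[H] ▷ H ⊗≫ ((H ⊗ H) ◁ (H ◁ η[H]) ≫ σ ▷ (H ⊗ H)) ≫
        B ◁ μ[H] := by
      rw [whisker_exchange]; monoidal
    _ = 𝟙 _ ⊗≫ Δ[H] ⊗≫ (H ◁ η[H] ≫ σ) ▷ H ⊗≫ B ◁ (H ◁ η[H] ≫ μ[H]) := by
      rw [whisker_exchange]; monoidal
    _ = 𝟙 _ ⊗≫ (Δ[H] ≫ ε[H] ▷ H) ⊗≫ η[B] ▷ H := by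
      rw [h.right_one, MonObj.mul_one]; monoidal
    _ = _ := by rw [counit_comul]; monoidal

theorem IsWeakAction.actSwap_one {act : H ⊗ B ⟶ B} (h : IsWeakAction act) :
    H ◁ η[B] ≫ actSwap act = (ρ_ H).hom ≫ inclRight B H := by
  simp only [actSwap, inclRight]
  calc
    _ = (H ◁ η[B] ≫ Δ[H] ▷ B) ⊗≫ H ◁ braid H B ⊗≫ act ▷ H := by monoidal
    _ = 𝟙 _ ⊗≫ Δ[H] ▷ 𝟙_ (YD k D) ⊗≫ H ◁ (H ◁ η[B] ≫ braid H B) ⊗≫ act ▷ H := by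
      rw [whisker_exchange]; monoidal
    _ = 𝟙 _ ⊗≫ Δ[H] ⊗≫ (H ◁ η[B] ≫ act) ▷ H := by
      rw [braid_naturality_right, braid_unit_right]; monoidal
    _ = 𝟙 _ ⊗≫ (Δ[H] ≫ ε[H] ▷ H) ⊗≫ η[B] ▷ H := by rw [h.act_one]; monoidal
    _ = _ := by rw [counit_comul]; monoidal

/-- The product `(1 # h) (c # g)`. -/
def crossedMulRight (act : H ⊗ B ⟶ B) (σ : H ⊗ H ⟶ B) : H ⊗ (B ⊗ H) ⟶ B ⊗ H :=
  (α_ H B H).inv ≫ actSwap act ▷ H ≫ (α_ B H H).hom ≫ B ◁ comulTensor σ μ[H] ≫ freeAct B H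

theorem inclRight_crossedMul (act : H ⊗ B ⟶ B) (σ : H ⊗ H ⟶ B) :
    inclRight B H ▷ (B ⊗ H) ≫ crossedMul act σ = crossedMulRight act σ := by
  rw [crossedMul_eq]
  change _ ≫ _ ≫ B ◁ crossedMulRight act σ ≫ _ = _
  conv_rhs => rw [← one_freeAct (crossedMulRight act σ)]
  simp only [inclRight]
  monoidal

theorem inclLeft_crossedMul (act : H ⊗ B ⟶ B) (σ : H ⊗ H ⟶ B) :
    inclLeft B H ▷ (B ⊗ H) ≫ crossedMul act σ =
      B ◁ ((λ_ (B ⊗ H)).inv ≫ η[H] ▷ (B ⊗ H) ≫ crossedMulRight act σ) ≫ freeAct B H := by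
  rw [crossedMul_eq]
  change _ ≫ _ ≫ B ◁ crossedMulRight act σ ≫ _ = _
  simp only [inclLeft]
  monoidal

theorem inclRight_crossedMulRight {act : H ⊗ B ⟶ B} (h : IsWeakAction act) (σ : H ⊗ H ⟶ B) :
    H ◁ inclRight B H ≫ crossedMulRight act σ = comulTensor σ μ[H] := by
  conv_rhs => rw [← one_freeAct (comulTensor σ μ[H])]
  have h₁ := h.actSwap_one
  simp only [inclRight, crossedMulRight] at h₁ ⊢
  calc
    _ = 𝟙 _ ⊗≫ (H ◁ η[B] ≫ actSwap act) ▷ H ⊗≫ B ◁ comulTensor σ μ[H] ≫ freeAct B H := by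
      monoidal
    _ = _ := by rw [h₁]; monoidal

theorem inclLeft_crossedMulRight {act : H ⊗ B ⟶ B} {σ : H ⊗ H ⟶ B} (h : IsTwoCocycle act σ) :
    H ◁ inclLeft B H ≫ crossedMulRight act σ = actSwap act := by
  have h₁ := h.comulTensor_one
  have h₂ := inclRight_freeAct (B := B) (X := H)
  simp only [inclLeft, crossedMulRight] at h₁ ⊢
  calc
    _ = 𝟙 _ ⊗≫ ((H ⊗ B) ◁ η[H] ≫ actSwap act ▷ H) ⊗≫ B ◁ comulTensor σ μ[H] ≫ freeAct B H := by
      monoidal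
    _ = actSwap act ⊗≫ B ◁ (H ◁ η[H] ≫ comulTensor σ μ[H]) ≫ freeAct B H := by
      rw [whisker_exchange]; monoidal
    _ = actSwap act ≫ B ◁ inclRight B H ≫ freeAct B H := by rw [h₁]; monoidal
    _ = _ := by rw [h₂]; simp

variable [MonObj A]

/-- In a crossed product, `b ↦ b # 1` and `h ↦ 1 # h` satisfy the commutation rules. -/
theorem IsCrossedProductIso.isCrossedPair {act : H ⊗ B ⟶ B} {σ : H ⊗ H ⟶ B} {e : B ⊗ H ≅ A}
    (hact : IsWeakAction act) (hσ : IsTwoCocycle act σ) (h : IsCrossedProductIso act σ e) :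
    mulHom (inclLeft B H ≫ e.hom) (inclRight B H ≫ e.hom) = e.hom ∧
      IsCrossedPair act σ (inclLeft B H ≫ e.hom) (inclRight B H ≫ e.hom) := by
  have hmul {X Y : YD k D} (f : X ⟶ B ⊗ H) (g : Y ⟶ B ⊗ H) :
      mulHom (f ≫ e.hom) (g ≫ e.hom) = X ◁ g ≫ f ▷ (B ⊗ H) ≫ crossedMul act σ ≫ e.hom := by
    rw [h.mul, ← mulHom, whiskerRight_mulHom, whiskerLeft_mulHom]
  have hone : η[B] ≫ inclLeft B H ≫ e.hom = η[A] := by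
    rw [← h.one, inclLeft, crossedOne, MonoidalCategory.tensorHom_def]
    monoidal
  have hone' : η[H] ≫ inclRight B H ≫ e.hom = η[A] := by
    rw [← h.one, inclRight, crossedOne, tensorHom_def']
    monoidal
  -- the unit law of `A` gives `(1 # 1) (c # g) = c # g`
  have hunit : (λ_ (B ⊗ H)).inv ≫ η[H] ▷ (B ⊗ H) ≫ crossedMulRight act σ = 𝟙 _ := by
    rw [← cancel_mono e.hom, ← inclRight_crossedMul]
    have := hmul (η[H] ≫ inclRight B H) (𝟙 (B ⊗ H))
    rw [Category.assoc, hone', one_mulHom] at this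
    simp only [Category.assoc, MonoidalCategory.whiskerLeft_id, comp_whiskerRight,
      Category.id_comp] at this ⊢
    rw [← this, Iso.inv_hom_id_assoc]
  have hl {Y : YD k D} (g : Y ⟶ B ⊗ H) :
      mulHom (inclLeft B H ≫ e.hom) (g ≫ e.hom) = B ◁ g ≫ freeAct B H ≫ e.hom := by
    rw [hmul, reassoc_of% inclLeft_crossedMul, hunit]
    simp
  have hr {Y : YD k D} (g : Y ⟶ B ⊗ H) : mulHom (inclRight B H ≫ e.hom) (g ≫ e.hom) =
      H ◁ g ≫ crossedMulRight act σ ≫ e.hom := by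
    rw [hmul, reassoc_of% inclRight_crossedMul]
  have he : mulHom (inclLeft B H ≫ e.hom) (inclRight B H ≫ e.hom) = e.hom := by
    rw [hl, reassoc_of% inclRight_freeAct]
  refine ⟨he, ⟨⟨hone, ?_⟩, hone', ?_, ?_⟩⟩
  · rw [← mulHom, hl, reassoc_of% inclLeft_freeAct]
  · rw [he, hr, reassoc_of% inclLeft_crossedMulRight hσ]
  · rw [he, hr, reassoc_of% inclRight_crossedMulRight hact]

namespace IsCrossedPair

variable {act : H ⊗ B ⟶ B} {σ : H ⊗ H ⟶ B} {p : B ⟶ A} {j : H ⟶ A} {e : B ⊗ H ≅ A}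

theorem act_eq (h : IsCrossedPair act σ p j) (he : e.hom = mulHom p j) :
    mulHom j p ≫ e.inv ≫ projLeft B H = act := by
  rw [h.act_comm, ← he, Category.assoc, e.hom_inv_id_assoc, projLeft, actSwap_counit]

theorem cocycle_eq (h : IsCrossedPair act σ p j) (he : e.hom = mulHom p j) :
    mulHom j j ≫ e.inv ≫ projLeft B H = σ := by
  rw [h.mul_comm, ← he, Category.assoc, e.hom_inv_id_assoc, projLeft, comulTensor_counit]

theorem inv_projLeft (h : IsCrossedPair act σ p j) (he : e.hom = mulHom p j) :
    j ≫ e.inv ≫ projLeft B H = ε[H] ≫ η[B] := by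
  have := h.isMonHom
  conv_lhs => rw [← inclRight_mulHom p j, ← he, Category.assoc, e.hom_inv_id_assoc]
  exact inclRight_projLeft

theorem mulHom_mulHom (h : IsCrossedPair act σ p j) {Y : YD k D} (f : Y ⟶ A) :
    mulHom j (mulHom p f) = (α_ H B Y).inv ≫ actSwap act ▷ Y ≫ (α_ B H Y).hom ≫
      mulHom p (mulHom j f) := by
  rw [← mulHom_assoc, whiskerRight_mulHom, ← h.act_comm, mulHom_assoc, Iso.inv_hom_id_assoc]

theorem isWeakAction (h : IsCrossedPair act σ p j) (he : e.hom = mulHom p j) :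
    IsWeakAction act where
  act_mul := by
    have := h.isMonHom
    have h₁ : μ[B] ≫ p = mulHom p p := IsMonHom.mul_hom p
    calc
      _ = mulHom j (mulHom p p) ≫ e.inv ≫ projLeft B H := by
        rw [← h₁, ← whiskerLeft_mulHom, Category.assoc, h.act_eq he]
      _ = (α_ H B B).inv ≫ actSwap act ▷ B ≫ (α_ B H B).hom ≫ B ◁ act ≫ μ[B] := by
        rw [h.mulHom_mulHom]
        simp only [Category.assoc]
        rw [mulHom_inv_projLeft p he, h.act_eq he]
      _ = _ := by
        simp only [actSwap, midSwap, MonoidalCategory.tensorHom_def]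
        monoidal
  act_one := by
    have := h.isMonHom
    rw [← h.act_eq he, reassoc_of% whiskerLeft_mulHom, IsMonHom.one_hom, mulHom_one,
      Category.assoc, h.inv_projLeft he]

theorem isTwoCocycle (h : IsCrossedPair act σ p j) (he : e.hom = mulHom p j) :
    IsTwoCocycle act σ where
  cocycle := by
    have := h.isMonHom
    have h₁ : mulHom j (mulHom j j) ≫ e.inv ≫ projLeft B H = H ◁ comulTensor σ μ[H] ≫
        (α_ H B H).inv ≫ actSwap act ▷ H ≫ (α_ B H H).hom ≫ B ◁ σ ≫ μ[B] := by
      rw [h.mul_comm, ← whiskerLeft_mulHom, h.mulHom_mulHom]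
      simp only [Category.assoc]
      rw [mulHom_inv_projLeft p he, h.cocycle_eq he]
    have h₂ : mulHom (mulHom j j) j ≫ e.inv ≫ projLeft B H =
        comulTensor σ μ[H] ▷ H ≫ (α_ B H H).hom ≫ B ◁ σ ≫ μ[B] := by
      rw [h.mul_comm, ← whiskerRight_mulHom, mulHom_assoc]
      simp only [Category.assoc]
      rw [mulHom_inv_projLeft p he, h.cocycle_eq he]
    rw [← h₂, mulHom_assoc, Category.assoc, Iso.inv_hom_id_assoc, h₁]
    simp only [actSwap, midSwap, tensorHom_def' Δ[H], MonoidalCategory.tensorHom_def act]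
    monoidal
  right_one := by
    rw [← h.cocycle_eq he, reassoc_of% whiskerLeft_mulHom, h.one, mulHom_one,
      Category.assoc, h.inv_projLeft he]
  left_one := by
    rw [← h.cocycle_eq he, reassoc_of% whiskerRight_mulHom, h.one, one_mulHom,
      Category.assoc, h.inv_projLeft he]

theorem isCrossedProductIso (h : IsCrossedPair act σ p j) (he : e.hom = mulHom p j) :
    IsCrossedProductIso act σ e where
  mul := by rw [he, h.crossedMul_comp, ← he, mulHom]
  one := by rw [he, h.crossedOne_comp]

end IsCrossedPair

end YetterDrinfeld.YD

/-! ### Comodule algebras and tensor products over the coinvariants -/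

namespace CategoryTheory.MonoidalCategory

variable {C : Type*} [Category* C] [MonoidalCategory C] {A B X Y : C}

theorem freeCoact_projLeft [ComonObj X] : freeCoact B X ≫ projLeft B X ▷ X = 𝟙 _ := by
  simp only [freeCoact, projLeft]
  calc
    _ = 𝟙 _ ⊗≫ B ◁ (Δ[X] ≫ ε[X] ▷ X) ⊗≫ 𝟙 _ := by monoidal
    _ = _ := by rw [counit_comul]; monoidal

theorem freeCoact_counit [ComonObj X] : freeCoact B X ≫ (B ⊗ X) ◁ ε[X] = (ρ_ (B ⊗ X)).inv := by
  simp only [freeCoact]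
  calc
    _ = 𝟙 _ ⊗≫ B ◁ (Δ[X] ≫ X ◁ ε[X]) ⊗≫ 𝟙 _ := by monoidal
    _ = _ := by rw [comul_counit]; monoidal

theorem freeCoact_freeCoact [ComonObj X] : freeCoact B X ≫ freeCoact B X ▷ X ≫
    (α_ (B ⊗ X) X X).hom = freeCoact B X ≫ (B ⊗ X) ◁ Δ[X] := by
  simp only [freeCoact]
  calc
    _ = 𝟙 _ ⊗≫ B ◁ (Δ[X] ≫ Δ[X] ▷ X ≫ (α_ X X X).hom) ⊗≫ 𝟙 _ := by monoidal
    _ = _ := by rw [← comul_assoc]; monoidal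

variable [MonObj A] [MonObj B]

theorem inclRight_freeCoact [ComonObj X] :
    inclRight B X ≫ freeCoact B X = Δ[X] ≫ inclRight B X ▷ X := by
  simp only [inclRight, freeCoact]
  calc
    _ = 𝟙 _ ⊗≫ (η[B] ▷ X ≫ B ◁ Δ[X]) ⊗≫ 𝟙 _ := by monoidal
    _ = _ := by rw [← whisker_exchange]; monoidal

theorem mulHom_def (f : X ⟶ A) (g : Y ⟶ A) : mulHom f g = (f ⊗ₘ g) ≫ μ[A] := rfl

theorem mulHom_eq (f : X ⟶ A) (g : Y ⟶ A) : mulHom f g = X ◁ g ≫ f ▷ A ≫ μ[A] := by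
  rw [mulHom, tensorHom_def', Category.assoc]

theorem mulHom_eq' (f : X ⟶ A) (g : Y ⟶ A) : mulHom f g = f ▷ Y ≫ A ◁ g ≫ μ[A] := by
  rw [mulHom, MonoidalCategory.tensorHom_def, Category.assoc]

/-- If `e : b ⊗ x ↦ p(b) j(x)` is an isomorphism from `B ⊗ X` to `A`, then `A ⊗ X` is the tensor
product `A ⊗_B A`, as a split coequaliser. -/
def tensorOverSplit (p : B ⟶ A) [IsMonHom p] (j : X ⟶ A) (e : B ⊗ X ≅ A)
    (he : e.hom = mulHom p j) :
    IsSplitCoequalizer ((A ◁ p ≫ μ[A]) ▷ A) ((α_ A B A).hom ≫ A ◁ (p ▷ A ≫ μ[A]))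
      (A ◁ e.inv ≫ (α_ A B X).inv ≫ (A ◁ p ≫ μ[A]) ▷ X) where
  rightSection := A ◁ j
  leftSection := A ◁ (e.inv ≫ B ◁ j) ≫ (α_ A B A).inv
  condition := by
    have h₁ : (p ▷ A ≫ μ[A]) ≫ e.inv = B ◁ e.inv ≫ freeAct B X := by
      have h := mulHom_mulHom_left p j e.inv
      rw [← he, e.inv_hom_id, mulHom_eq, MonoidalCategory.whiskerLeft_id, Category.id_comp] at h
      rw [h]
      simp
    have h₂ : (A ◁ p ≫ μ[A]) ▷ B ≫ A ◁ p ≫ μ[A] =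
        (α_ A B B).hom ≫ A ◁ μ[B] ≫ A ◁ p ≫ μ[A] := by
      have h : A ◁ p ≫ μ[A] = mulHom (𝟙 A) p := by simp [mulHom_eq]
      rw [h, whiskerRight_mulHom, Category.comp_id, mulHom_assoc, whiskerLeft_mulHom,
        IsMonHom.mul_hom, ← mulHom]
    calc
      _ = ((A ◁ p ≫ μ[A]) ▷ A ≫ A ◁ e.inv) ⊗≫ (A ◁ p ≫ μ[A]) ▷ X := by monoidal
      _ = (A ⊗ B) ◁ e.inv ⊗≫ ((A ◁ p ≫ μ[A]) ▷ B ≫ A ◁ p ≫ μ[A]) ▷ X := by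
        rw [← whisker_exchange]; monoidal
      _ = 𝟙 _ ⊗≫ A ◁ (B ◁ e.inv ≫ freeAct B X) ⊗≫ (A ◁ p ≫ μ[A]) ▷ X := by
        rw [h₂, freeAct]; monoidal
      _ = _ := by rw [← h₁]; monoidal
  rightSection_π := by
    have h : j ≫ e.inv = inclRight B X := by
      rw [Iso.comp_inv_eq, he, inclRight_mulHom]
    rw [← MonoidalCategory.whiskerLeft_comp_assoc, h, inclRight]
    calc
      _ = 𝟙 _ ⊗≫ (A ◁ (η[B] ≫ p) ≫ μ[A]) ▷ X := by monoidal
      _ = _ := by rw [IsMonHom.one_hom, MonObj.mul_one]; monoidal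
  leftSection_bottom := by
    have h : e.inv ≫ B ◁ j ≫ p ▷ A ≫ μ[A] = 𝟙 _ := by
      rw [← mulHom_eq, ← he, e.inv_hom_id]
    rw [Category.assoc, Iso.inv_hom_id_assoc, ← MonoidalCategory.whiskerLeft_comp,
      Category.assoc, h, MonoidalCategory.whiskerLeft_id]
  leftSection_top := by
    calc
      _ = A ◁ e.inv ⊗≫ ((A ⊗ B) ◁ j ≫ (A ◁ p ≫ μ[A]) ▷ A) := by monoidal
      _ = _ := by rw [whisker_exchange]; monoidal

end CategoryTheory.MonoidalCategory

namespace YetterDrinfeld.YD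

variable {k D : Type u} [Field k] [Ring D] [HopfAlgebra k D]
variable {H B A : YD k D} [BraidedHopf H]

theorem inclLeft_projLeft (H B : YD k D) [BraidedHopf H] :
    inclLeft B H ≫ projLeft B H = 𝟙 B := by
  rw [inclLeft, projLeft, Category.assoc, ← MonoidalCategory.whiskerLeft_comp_assoc,
    BraidedHopf.one_counit]
  simp

theorem inclLeft_freeCoact (H B : YD k D) [BraidedHopf H] :
    inclLeft B H ≫ freeCoact B H = inclLeft B H ≫ (ρ_ (B ⊗ H)).inv ≫ (B ⊗ H) ◁ η[H] := by
  have h₁ := BraidedHopf.one_comul (H := H)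
  simp only [inclLeft, freeCoact, MonoidalCategory.tensorHom_def] at h₁ ⊢
  calc
    _ = 𝟙 _ ⊗≫ B ◁ (η[H] ≫ Δ[H]) ⊗≫ 𝟙 _ := by monoidal
    _ = _ := by rw [h₁]; monoidal

variable {ψ : A ⟶ A ⊗ H} {e : B ⊗ H ≅ A}

theorem IsRightColinear.inv (h : IsRightColinear ψ e.hom) :
    e.inv ≫ freeCoact B H = ψ ≫ e.inv ▷ H := by
  have h' : e.hom ≫ ψ = freeCoact B H ≫ e.hom ▷ H := h
  rw [Iso.inv_comp_eq, reassoc_of% h', ← comp_whiskerRight, e.hom_inv_id]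
  simp

/-- The `B`-component of `e⁻¹` determines `e⁻¹`, which is colinear. -/
theorem IsRightColinear.inv_eq (h : IsRightColinear ψ e.hom) :
    e.inv = ψ ≫ (e.inv ≫ projLeft B H) ▷ H := by
  rw [comp_whiskerRight, ← reassoc_of% h.inv, freeCoact_projLeft, Category.comp_id]

/-- `B` is the algebra of coinvariants of `B ⊗ H`. -/
theorem IsRightColinear.isCoinvariants (h : IsRightColinear ψ e.hom) :
    IsCoinvariants ψ (inclLeft B H ≫ e.hom) := by
  have h' : e.hom ≫ ψ = freeCoact B H ≫ e.hom ▷ H := h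
  have w : (inclLeft B H ≫ e.hom) ≫ ψ = (inclLeft B H ≫ e.hom) ≫ (ρ_ A).inv ≫ A ◁ η[H] := by
    rw [Category.assoc, h', reassoc_of% inclLeft_freeCoact, whisker_exchange,
      ← rightUnitor_inv_naturality_assoc, Category.assoc]
  refine ⟨w, ⟨Fork.IsLimit.mk _ (fun s => s.ι ≫ e.inv ≫ projLeft B H) (fun s => ?_)
    fun s m hm => ?_⟩⟩
  · have hs : s.ι ≫ ψ = s.ι ≫ (ρ_ A).inv ≫ A ◁ η[H] := s.condition
    have hs' : s.ι ≫ e.inv = (s.ι ≫ e.inv ≫ projLeft B H) ≫ inclLeft B H := by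
      conv_lhs => rw [h.inv_eq, reassoc_of% hs, whisker_exchange,
        ← rightUnitor_inv_naturality_assoc]
      simp [inclLeft]
    change _ ≫ inclLeft B H ≫ e.hom = s.ι
    rw [← Category.assoc, ← hs', Category.assoc, e.inv_hom_id, Category.comp_id]
  · have hm' : m ≫ inclLeft B H ≫ e.hom = s.ι := hm
    rw [← hm']
    simp [inclLeft_projLeft]

variable [MonObj B]

theorem IsRightColinear.inclRight_comp (h : IsRightColinear ψ e.hom) :
    (inclRight B H ≫ e.hom) ≫ ψ = Δ[H] ≫ (inclRight B H ≫ e.hom) ▷ H := by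
  have h' : e.hom ≫ ψ = freeCoact B H ≫ e.hom ▷ H := h
  rw [Category.assoc, h', reassoc_of% inclRight_freeCoact, comp_whiskerRight]

variable [MonObj A]

namespace IsCrossedPair

variable {act : H ⊗ B ⟶ B} {σ : H ⊗ H ⟶ B} {p : B ⟶ A} {j : H ⟶ A}

theorem isComoduleAlgebra (h : IsCrossedPair act σ p j) (he : e.hom = mulHom p j)
    (hψ : IsRightColinear ψ e.hom) : IsComoduleAlgebra ψ := by
  have := h.isMonHom
  have h' : e.hom ≫ ψ = freeCoact B H ≫ e.hom ▷ H := hψ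
  refine ⟨?_, ?_, ?_, ?_⟩
  · rw [← cancel_epi e.hom, reassoc_of% h', ← whisker_exchange, reassoc_of% freeCoact_counit,
      rightUnitor_inv_naturality]
  · rw [← cancel_epi e.hom, reassoc_of% h', reassoc_of% h', ← whisker_exchange,
      ← reassoc_of% freeCoact_freeCoact, ← comp_whiskerRight_assoc, h']
    simp
  · rw [← cancel_epi (e.hom ⊗ₘ e.hom)]
    have hmul := (h.isCrossedProductIso he).mul.symm
    rw [reassoc_of% hmul, h', reassoc_of% crossedMul_comul, tensorHom_comp_tensorHom_assoc, h',
      ← tensorHom_comp_tensorHom_assoc, ← tensorHom_id, reassoc_of% midSwap_naturality,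
      tensorHom_comp_tensorHom, tensorHom_comp_tensorHom, hmul]
    simp
  · have h₁ : η[H] ≫ inclRight B H ≫ e.hom = η[A] := by rw [he, inclRight_mulHom, h.one]
    rw [← h₁, Category.assoc, Category.assoc, h', reassoc_of% inclRight_freeCoact,
      reassoc_of% BraidedHopf.one_comul, ← comp_whiskerRight, ← tensorHom_id,
      tensorHom_comp_tensorHom, Category.comp_id]

end IsCrossedPair

/-- In a comodule algebra with a normal basis, an algebra map `p` to the coinvariants and a unital
colinear map `j` satisfy commutation rules. The weak action and the cocycle are the `B`-components
of `j(h) p(b)` and of `j(h) j(g)`. -/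
theorem IsComoduleAlgebra.isCrossedPair (h : IsComoduleAlgebra ψ) {p : B ⟶ A} [hp : IsMonHom p]
    {j : H ⟶ A} (hw : p ≫ ψ = p ≫ (ρ_ A).inv ≫ A ◁ η[H]) (he : e.hom = mulHom p j)
    (hψ : IsRightColinear ψ e.hom) (hj : η[H] ≫ j = η[A]) :
    IsCrossedPair (mulHom j p ≫ e.inv ≫ projLeft B H) (mulHom j j ≫ e.inv ≫ projLeft B H) p j := by
  have hjψ : j ≫ ψ = (Δ[H] ≫ j ▷ H : H ⟶ A ⊗ H) := by
    have := hψ.inclRight_comp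
    rwa [he, inclRight_mulHom] at this
  refine ⟨hp, hj, ?_, ?_⟩
  · have hpψ : p ≫ ψ = (ρ_ B).inv ≫ (p ⊗ₘ η[H]) := by
      rw [hw, rightUnitor_inv_naturality_assoc, MonoidalCategory.tensorHom_def]
    rw [← he, ← Iso.comp_inv_eq]
    conv_lhs => rw [hψ.inv_eq]
    rw [mulHom, Category.assoc, reassoc_of% h.mul, tensorHom_comp_tensorHom_assoc, hjψ, hpψ,
      ← tensorHom_comp_tensorHom_assoc, ← tensorHom_id, reassoc_of% midSwap_naturality,
      tensorHom_comp_tensorHom_assoc, ← tensorHom_id, tensorHom_comp_tensorHom,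
      ← mulHom_def (𝟙 H), mulHom_one, Category.comp_id, Category.comp_id, Category.assoc,
      ← reassoc_of% mulHom_def j p]
    generalize mulHom j p ≫ e.inv ≫ projLeft B H = a
    simp only [actSwap, midSwap, MonoidalCategory.tensorHom_def]
    monoidal
  · rw [← he, ← Iso.comp_inv_eq]
    conv_lhs => rw [hψ.inv_eq]
    rw [mulHom, Category.assoc, reassoc_of% h.mul, tensorHom_comp_tensorHom_assoc, hjψ,
      ← tensorHom_comp_tensorHom_assoc, ← tensorHom_id, reassoc_of% midSwap_naturality,
      tensorHom_comp_tensorHom_assoc, ← tensorHom_id, tensorHom_comp_tensorHom]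
    simp [comulTensor]

end YetterDrinfeld.YD

/-! ### The Galois condition and normal bases -/

namespace YetterDrinfeld.YD

variable {k D : Type u} [Field k] [Ring D] [HopfAlgebra k D]
variable {H B A : YD k D}

section

variable [MonObj B]

/-- Right multiplication by an element of `B`. -/
def rightMul (x : 𝟙_ (YD k D) ⟶ B) : B ⟶ B := (ρ_ B).inv ≫ B ◁ x ≫ μ[B]

theorem rightMul_comp (x y : 𝟙_ (YD k D) ⟶ B) :
    rightMul x ≫ rightMul y = rightMul ((λ_ _).inv ≫ mulHom x y) := by
  simp only [rightMul, mulHom, tensorHom_def']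
  calc
    _ = 𝟙 _ ⊗≫ B ◁ x ⊗≫ (μ[B] ▷ 𝟙_ (YD k D) ≫ B ◁ y) ≫ μ[B] := by monoidal
    _ = 𝟙 _ ⊗≫ (B ◁ x ▷ 𝟙_ (YD k D) ≫ B ◁ B ◁ y) ⊗≫ (μ[B] ▷ B ≫ μ[B]) := by
      rw [← whisker_exchange]; monoidal
    _ = _ := by
      rw [MonObj.mul_assoc, ← MonoidalCategory.whiskerLeft_comp, ← whisker_exchange]; monoidal

theorem rightMul_one : rightMul η[B] = 𝟙 B := by simp [rightMul]

theorem one_rightMul (x : 𝟙_ (YD k D) ⟶ B) : η[B] ≫ rightMul x = x := by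
  rw [rightMul, rightUnitor_inv_naturality_assoc, ← mulHom_eq', one_mulHom]
  monoidal

theorem freeAct_rightMul (x : 𝟙_ (YD k D) ⟶ B) :
    freeAct B H ≫ rightMul x ▷ H = B ◁ rightMul x ▷ H ≫ freeAct B H := by
  simp only [freeAct, rightMul]
  calc
    _ = 𝟙 _ ⊗≫ (μ[B] ▷ 𝟙_ (YD k D) ≫ B ◁ x) ▷ H ⊗≫ μ[B] ▷ H := by monoidal
    _ = 𝟙 _ ⊗≫ B ◁ B ◁ x ▷ H ⊗≫ (μ[B] ▷ B ≫ μ[B]) ▷ H := by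
      rw [← whisker_exchange]; monoidal
    _ = _ := by rw [MonObj.mul_assoc]; monoidal

variable [MonObj A] {p : B ⟶ A} {j : H ⟶ A} {e : B ⊗ H ≅ A}

theorem IsLeftLinear.eq_mulHom (h : IsLeftLinear p e.hom) :
    e.hom = mulHom p (inclRight B H ≫ e.hom) := by
  have h' : freeAct B H ≫ e.hom = B ◁ e.hom ≫ p ▷ A ≫ μ[A] := h
  rw [mulHom_eq, MonoidalCategory.whiskerLeft_comp, Category.assoc, ← h',
    reassoc_of% inclRight_freeAct]

theorem isLeftLinear_of_eq_mulHom [IsMonHom p] (h : e.hom = mulHom p j) :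
    IsLeftLinear p e.hom := by
  change freeAct B H ≫ e.hom = B ◁ e.hom ≫ p ▷ A ≫ μ[A]
  rw [← mulHom_eq, h, ← Category.id_comp (mulHom p j), mulHom_mulHom_left]
  simp

end

variable [BraidedHopf H]

/-- The comultiplication of `H ⊗ H` followed by `H ⊗ H ⟶ H ⊗ H, h ⊗ g ↦ h g₁ ⊗ g₂` in the second
factor. -/
theorem comulTensor_twist_id (σ : H ⊗ H ⟶ B) : comulTensor σ (twist (𝟙 H)) =
    H ◁ Δ[H] ≫ (α_ H H H).inv ≫ comulTensor σ μ[H] ▷ H ≫ (α_ B H H).hom := by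
  simp only [comulTensor, twist, midSwap, tensorHom_def', MonoidalCategory.whiskerLeft_id,
    Category.id_comp]
  calc
    _ = 𝟙 _ ⊗≫ H ◁ Δ[H] ⊗≫ Δ[H] ▷ (H ⊗ H) ⊗≫ H ◁ (braid H H ▷ H ≫ (H ⊗ H) ◁ Δ[H]) ⊗≫
        (H ⊗ H) ◁ μ[H] ▷ H ⊗≫ σ ▷ (H ⊗ H) := by monoidal
    _ = 𝟙 _ ⊗≫ H ◁ Δ[H] ⊗≫ (Δ[H] ▷ (H ⊗ H) ≫ (H ⊗ H) ◁ (H ◁ Δ[H])) ⊗≫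
        H ◁ braid H H ▷ (H ⊗ H) ⊗≫ (H ⊗ H) ◁ μ[H] ▷ H ⊗≫ σ ▷ (H ⊗ H) := by
      rw [← whisker_exchange]; monoidal
    _ = 𝟙 _ ⊗≫ H ◁ (Δ[H] ≫ H ◁ Δ[H]) ⊗≫ Δ[H] ▷ (H ⊗ H ⊗ H) ⊗≫
        H ◁ braid H H ▷ (H ⊗ H) ⊗≫ (H ⊗ H) ◁ μ[H] ▷ H ⊗≫ σ ▷ (H ⊗ H) := by
      rw [← whisker_exchange]; monoidal
    _ = _ := by rw [comul_assoc]; monoidal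

variable [MonObj B]

theorem convInvertible_iff (σ : H ⊗ H ⟶ B) : ConvInvertible σ ↔ IsIso (twist σ) := by
  have h (f g : H ⊗ H ⟶ B) : comulTensor f g ≫ μ[B] = Δ[H ⊗ H] ≫ (f ⊗ₘ g) ≫ μ[B] := by
    rw [comulTensor_eq, Category.assoc]
  have h' : (ε[H] ⊗ₘ ε[H]) ≫ (λ_ (𝟙_ (YD k D))).hom ≫ η[B] = ε[H ⊗ H] ≫ η[B] :=
    (Category.assoc _ _ _).symm
  simp only [ConvInvertible, isIso_twist_iff, h, h']

/-- The canonical morphism `h ⊗ g ↦ h g₁ ⊗ g₂` of a Hopf algebra is an isomorphism, since the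
identity has the antipode as its convolution inverse. -/
theorem isIso_twist_id (H : YD k D) [BraidedHopf H] : IsIso (twist (𝟙 H)) := by
  rw [isIso_twist_iff]
  refine ⟨BraidedHopf.antipode, ?_, ?_⟩
  · simpa using BraidedHopf.antipode_right (H := H)
  · simpa using BraidedHopf.antipode_left (H := H)

variable [MonObj A]

theorem preCan_comp {ψ : A ⟶ A ⊗ H} {j : H ⟶ A} (hj : j ≫ ψ = Δ[H] ≫ j ▷ H) :
    A ◁ j ≫ preCan ψ = freeCoact A H ≫ mulHom (𝟙 A) j ▷ H := by
  rw [preCan, ← MonoidalCategory.whiskerLeft_comp_assoc, hj, freeCoact, mulHom]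
  simp

variable {ψ : A ⟶ A ⊗ H} {e : B ⊗ H ≅ A} {act : H ⊗ B ⟶ B} {σ : H ⊗ H ⟶ B} {p : B ⟶ A}
  {j : H ⟶ A}

/-- Along `e`, the morphism `a ⊗ h ↦ a j(h₁) ⊗ h₂` is the twist by the cocycle followed by the
canonical isomorphism of `H`. -/
theorem IsCrossedPair.canonical_eq (h : IsCrossedPair act σ p j) (he : e.hom = mulHom p j)
    (hψ : IsRightColinear ψ e.hom) : e.hom ▷ H ≫ A ◁ j ≫ preCan ψ =
      (α_ B H H).hom ≫ twist σ ≫ B ◁ twist (𝟙 H) ≫ (α_ B H H).inv ≫ e.hom ▷ H := by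
  have := h.isMonHom
  have hj : j ≫ ψ = Δ[H] ≫ j ▷ H := by
    have := hψ.inclRight_comp
    rwa [he, inclRight_mulHom] at this
  have h₁ : mulHom e.hom j =
      (α_ B H H).hom ≫ B ◁ comulTensor σ μ[H] ≫ freeAct B H ≫ e.hom := by
    rw [he, mulHom_assoc, h.mul_comm, mulHom_mulHom_left]
  have h₂ := comulTensor_twist_id σ
  rw [comulTensor_eq, MonoidalCategory.tensorHom_def] at h₂
  rw [preCan_comp hj]
  calc
    _ = freeCoact (B ⊗ H) H ≫ mulHom e.hom j ▷ H := by
      have := whiskerRight_mulHom e.hom (𝟙 A) j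
      rw [Category.comp_id] at this
      rw [← this, freeCoact, freeCoact]
      calc
        _ = (e.hom ▷ H ≫ A ◁ Δ[H]) ⊗≫ mulHom (𝟙 A) j ▷ H := by monoidal
        _ = _ := by rw [← whisker_exchange]; monoidal
    _ = 𝟙 _ ⊗≫ B ◁ (H ◁ Δ[H] ≫ (α_ H H H).inv ≫ comulTensor σ μ[H] ▷ H ≫ (α_ B H H).hom) ⊗≫
        μ[B] ▷ (H ⊗ H) ⊗≫ e.hom ▷ H := by
      rw [h₁, freeCoact, freeAct]; monoidal
    _ = 𝟙 _ ⊗≫ B ◁ Δ[H ⊗ H] ⊗≫ B ◁ σ ▷ (H ⊗ H) ⊗≫ ((B ⊗ B) ◁ twist (𝟙 H) ≫ μ[B] ▷ (H ⊗ H)) ⊗≫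
        e.hom ▷ H := by
      rw [← h₂]; monoidal
    _ = _ := by
      rw [whisker_exchange, twist.eq_1 σ]; monoidal

/-- The morphism `a ⊗ h ↦ a j(h₁) ⊗ h₂` is an isomorphism if and only if the cocycle is
convolution invertible. -/
theorem IsCrossedPair.isIso_canonical_iff (h : IsCrossedPair act σ p j) (he : e.hom = mulHom p j)
    (hψ : IsRightColinear ψ e.hom) : IsIso (A ◁ j ≫ preCan ψ) ↔ ConvInvertible σ := by
  have := isIso_twist_id H
  rw [convInvertible_iff]
  have heq := h.canonical_eq he hψ
  constructor
  · intro hi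
    have : twist σ = ((α_ B H H).inv ≫ e.hom ▷ H ≫ A ◁ j ≫ preCan ψ) ≫
        inv (B ◁ twist (𝟙 H) ≫ (α_ B H H).inv ≫ e.hom ▷ H) := by
      rw [IsIso.eq_comp_inv, heq, Iso.inv_hom_id_assoc]
    rw [this]
    infer_instance
  · intro hi
    have : A ◁ j ≫ preCan ψ = inv (e.hom ▷ H) ≫
        (α_ B H H).hom ≫ twist σ ≫ B ◁ twist (𝟙 H) ≫ (α_ B H H).inv ≫ e.hom ▷ H := by
      rw [IsIso.eq_inv_comp, heq]
    rw [this]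
    infer_instance

/-- `preCan ψ` factors through `A ⊗_B A`, since `ψ` is left `B`-linear. -/
theorem preCan_balanced [IsMonHom p] (he : e.hom = mulHom p j) (hψ : IsRightColinear ψ e.hom) :
    ((A ◁ p ≫ μ[A]) ▷ A) ≫ preCan ψ = ((α_ A B A).hom ≫ A ◁ (p ▷ A ≫ μ[A])) ≫ preCan ψ := by
  have h' : e.hom ≫ ψ = freeCoact B H ≫ e.hom ▷ H := hψ
  have h₁ : B ◁ e.hom ≫ p ▷ A ≫ μ[A] = freeAct B H ≫ e.hom := by
    rw [← mulHom_eq, he, ← Category.id_comp (mulHom p j), mulHom_mulHom_left]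
    simp
  have h₂ : freeAct B H ≫ freeCoact B H =
      B ◁ freeCoact B H ≫ (α_ B (B ⊗ H) H).inv ≫ freeAct B H ▷ H := by
    simp only [freeAct, freeCoact]
    calc
      _ = 𝟙 _ ⊗≫ (μ[B] ▷ H ≫ B ◁ Δ[H]) ⊗≫ 𝟙 _ := by monoidal
      _ = _ := by rw [← whisker_exchange]; monoidal
  -- `ψ` is `B`-linear
  have h₃ : (p ▷ A ≫ μ[A]) ≫ ψ = B ◁ ψ ≫ (α_ B A H).inv ≫ (p ▷ A ≫ μ[A]) ▷ H := by
    rw [← cancel_epi (B ◁ e.hom)]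
    calc
      _ = (freeAct B H ≫ freeCoact B H) ≫ e.hom ▷ H := by
        rw [Category.assoc (freeAct B H), ← h', ← reassoc_of% h₁, Category.assoc]
      _ = B ◁ freeCoact B H ≫ (α_ B (B ⊗ H) H).inv ≫ (B ◁ e.hom ≫ p ▷ A ≫ μ[A]) ▷ H := by
        rw [h₂, h₁]; simp
      _ = B ◁ (freeCoact B H ≫ e.hom ▷ H) ≫ (α_ B A H).inv ≫ (p ▷ A ≫ μ[A]) ▷ H := by
        simp
      _ = _ := by rw [← h']; simp
  simp only [preCan]
  calc
    _ = ((A ◁ p ≫ μ[A]) ▷ A ≫ A ◁ ψ) ⊗≫ μ[A] ▷ H := by monoidal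
    _ = (A ⊗ B) ◁ ψ ⊗≫ (A ◁ p) ▷ A ▷ H ⊗≫ (μ[A] ▷ A ≫ μ[A]) ▷ H := by
      rw [← whisker_exchange]; monoidal
    _ = 𝟙 _ ⊗≫ A ◁ (B ◁ ψ ≫ (α_ B A H).inv ≫ (p ▷ A ≫ μ[A]) ▷ H) ⊗≫ μ[A] ▷ H := by
      rw [MonObj.mul_assoc]; monoidal
    _ = _ := by rw [← h₃]; monoidal

/-- An extension with a normal basis is Galois with split canonical epimorphism if and only if the
morphism `a ⊗ h ↦ a j(h₁) ⊗ h₂` is an isomorphism. -/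
theorem galois_iff [IsMonHom p] (he : e.hom = mulHom p j) (hψ : IsRightColinear ψ e.hom) :
    (∃ (Q : YD k D) (q : A ⊗ A ⟶ Q), IsTensorOver p q ∧ IsGalois ψ q ∧ IsSplitEpi q) ↔
      IsIso (A ◁ j ≫ preCan ψ) := by
  let S := tensorOverSplit p j e he
  constructor
  · rintro ⟨Q, q, ⟨w, ⟨hq⟩⟩, ⟨can, hcan⟩, -⟩
    let i : A ⊗ H ≅ Q := S.isCoequalizer.coconePointUniqueUpToIso hq
    have hi : (A ◁ e.inv ≫ (α_ A B H).inv ≫ (A ◁ p ≫ μ[A]) ▷ H) ≫ i.hom = q :=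
      S.isCoequalizer.comp_coconePointUniqueUpToIso_hom hq WalkingParallelPair.one
    have hs : A ◁ j ≫ A ◁ e.inv ≫ (α_ A B H).inv ≫ (A ◁ p ≫ μ[A]) ▷ H = 𝟙 _ := S.rightSection_π
    have : A ◁ j ≫ preCan ψ = i.hom ≫ can.hom := by
      calc
        _ = (A ◁ j ≫ A ◁ e.inv ≫ (α_ A B H).inv ≫ (A ◁ p ≫ μ[A]) ▷ H) ≫ i.hom ≫ can.hom := by
          rw [← hcan]
          conv_lhs => rw [← hi]
          simp
        _ = _ := by rw [hs, Category.id_comp]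
    rw [this]
    infer_instance
  · intro hiso
    refine ⟨A ⊗ H, A ◁ e.inv ≫ (α_ A B H).inv ≫ (A ◁ p ≫ μ[A]) ▷ H,
      ⟨S.condition, ⟨S.isCoequalizer⟩⟩, ⟨asIso (A ◁ j ≫ preCan ψ), ?_⟩,
      ⟨⟨S.rightSection, S.rightSection_π⟩⟩⟩
    have h₁ := S.leftSection_top
    have h₂ := S.leftSection_bottom
    rw [asIso_hom]
    change _ ≫ S.rightSection ≫ preCan ψ = preCan ψ
    rw [← Category.assoc, ← h₁, Category.assoc, preCan_balanced he hψ, ← Category.assoc, h₂,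
      Category.id_comp]

theorem rightMul_freeCoact (x : 𝟙_ (YD k D) ⟶ B) :
    rightMul x ▷ H ≫ freeCoact B H = freeCoact B H ≫ rightMul x ▷ H ▷ H := by
  simp only [freeCoact]
  rw [← whisker_exchange_assoc, Category.assoc, associator_inv_naturality_left]

/-- A normal basis can be chosen to send `1 ⊗ 1` to `1`: the image `p(u)` of `1 ⊗ 1` under any
normal basis is coinvariant and `u` has an inverse `v` in `B`, so that
`b ⊗ h ↦ e(b v ⊗ h)` will do. -/
theorem IsSplitGaloisWithNormalBasis.exists_normalised (h : IsSplitGaloisWithNormalBasis ψ p) :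
    ∃ e : B ⊗ H ≅ A, IsLeftLinear p e.hom ∧ IsRightColinear ψ e.hom ∧
      η[H] ≫ inclRight B H ≫ e.hom = η[A] := by
  have := h.isMonHom
  obtain ⟨e, hl, hr⟩ := h.normalBasis
  obtain ⟨w, ⟨hlim⟩⟩ := h.coinvariants
  have hmono : Mono p := mono_of_isLimit_fork hlim
  have he := hl.eq_mulHom
  set j := inclRight B H ≫ e.hom with hj
  -- `j(1) = p(u)` is coinvariant
  obtain ⟨u, hu⟩ : ∃ u : 𝟙_ (YD k D) ⟶ B, u ≫ p = η[H] ≫ j := by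
    refine ⟨hlim.lift (Fork.ofι (η[H] ≫ j) ?_), hlim.fac _ WalkingParallelPair.zero⟩
    rw [Category.assoc, hr.inclRight_comp, reassoc_of% BraidedHopf.one_comul,
      MonoidalCategory.tensorHom_def', Category.assoc, ← comp_whiskerRight, whisker_exchange,
      unitors_inv_equal, ← rightUnitor_inv_naturality_assoc]
  -- `1 = p(v) j(1)` since `e⁻¹(1)` is coinvariant
  let v : 𝟙_ (YD k D) ⟶ B := η[A] ≫ e.inv ≫ projLeft B H
  have hv : (λ_ _).inv ≫ (v ⊗ₘ η[H]) ≫ e.hom = η[A] := by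
    have : η[A] ≫ e.inv = (λ_ _).inv ≫ (v ⊗ₘ η[H]) := by
      rw [hr.inv_eq, reassoc_of% h.comoduleAlgebra.one, ← tensorHom_id, tensorHom_comp_tensorHom,
        Category.comp_id]
    rw [← reassoc_of% this, e.inv_hom_id, Category.comp_id]
  have hvu : rightMul v ≫ rightMul u = 𝟙 B := by
    rw [rightMul_comp, ← rightMul_one]
    congr 1
    rw [he, mulHom_def p j, tensorHom_comp_tensorHom_assoc, ← mulHom_def, ← hu] at hv
    rw [← cancel_mono p, Category.assoc, mulHom_comp, IsMonHom.one_hom, hv]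
  have hmono' : Mono (rightMul u) := by
    have : rightMul u ≫ p = inclLeft B H ≫ e.hom := by
      rw [he, inclLeft, Category.assoc, whiskerLeft_mulHom, ← hu, rightMul, Category.assoc,
        Category.assoc, IsMonHom.mul_hom, mulHom_eq, tensorHom_def',
        MonoidalCategory.whiskerLeft_comp, Category.assoc, Category.assoc]
    have : Mono (inclLeft B H) := mono_of_mono_fac (inclLeft_projLeft H B)
    have : Mono (rightMul u ≫ p) := by
      rw [‹rightMul u ≫ p = _›]; infer_instance
    exact mono_of_mono _ p
  -- `u v = 1` follows from `v u = 1`, as right multiplication by `u` is a monomorphism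
  let r : B ≅ B := ⟨rightMul v, rightMul u, hvu, by
    rw [← cancel_mono (rightMul u), Category.assoc, hvu, Category.comp_id, Category.id_comp]⟩
  refine ⟨whiskerRightIso r H ≪≫ e, ?_, ?_, ?_⟩
  · have h' : freeAct B H ≫ e.hom = B ◁ e.hom ≫ p ▷ A ≫ μ[A] := hl
    change freeAct B H ≫ rightMul v ▷ H ≫ e.hom =
      B ◁ (rightMul v ▷ H ≫ e.hom) ≫ p ▷ A ≫ μ[A]
    rw [reassoc_of% freeAct_rightMul, h', MonoidalCategory.whiskerLeft_comp_assoc]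
  · have h' : e.hom ≫ ψ = freeCoact B H ≫ e.hom ▷ H := hr
    change (rightMul v ▷ H ≫ e.hom) ≫ ψ = freeCoact B H ≫ (rightMul v ▷ H ≫ e.hom) ▷ H
    rw [Category.assoc, h', reassoc_of% rightMul_freeCoact, comp_whiskerRight]
  · change η[H] ≫ inclRight B H ≫ rightMul v ▷ H ≫ e.hom = η[A]
    rw [← hv, inclRight, Category.assoc, ← comp_whiskerRight_assoc, one_rightMul,
      leftUnitor_inv_naturality_assoc, tensorHom_def']
    simp

/-- Crossed products with convolution invertible cocycle are the split Galois extensions with normal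
basis, with the same coaction `ψ` and the same inclusion `p` of the coinvariants. -/
theorem crossedProduct_iff (ψ : A ⟶ A ⊗ H) (p : B ⟶ A) :
    (∃ (act : H ⊗ B ⟶ B) (σ : H ⊗ H ⟶ B), IsWeakAction act ∧ IsTwoCocycle act σ ∧
      ConvInvertible σ ∧ ∃ e : B ⊗ H ≅ A, IsCrossedProductIso act σ e ∧
        IsRightColinear ψ e.hom ∧ (ρ_ B).inv ≫ B ◁ η[H] ≫ e.hom = p) ↔
    IsSplitGaloisWithNormalBasis ψ p := by
  constructor
  · rintro ⟨act, σ, hact, hσ, hconv, e, he, hψ, hp⟩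
    obtain rfl : inclLeft B H ≫ e.hom = p := (Category.assoc _ _ _).trans hp
    obtain ⟨hm, hc⟩ := he.isCrossedPair hact hσ
    have := hc.isMonHom
    exact ⟨hc.isComoduleAlgebra hm.symm hψ, hc.isMonHom, hψ.isCoinvariants,
      (galois_iff hm.symm hψ).2 ((hc.isIso_canonical_iff hm.symm hψ).2 hconv),
      e, isLeftLinear_of_eq_mulHom hm.symm, hψ⟩
  · intro h
    have := h.isMonHom
    obtain ⟨e, hl, hr, hj⟩ := h.exists_normalised
    obtain ⟨w, -⟩ := h.coinvariants
    have he := hl.eq_mulHom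
    have hc := h.comoduleAlgebra.isCrossedPair w he hr hj
    refine ⟨_, _, hc.isWeakAction he, hc.isTwoCocycle he,
      (hc.isIso_canonical_iff he hr).1 ((galois_iff he hr).1 h.galois), e,
      hc.isCrossedProductIso he, hr, ?_⟩
    rw [he, whiskerLeft_mulHom, hj, mulHom_one, Iso.inv_hom_id_assoc]

end YetterDrinfeld.YD

end

theorem corollary2p1 {k D : Type u} [Field k] [Ring D] [HopfAlgebra k D] :
    (HasEqualizers (YD k D) ∧ HasCoequalizers (YD k D) ∧
      (∀ {E X Y : YD k D} (f g : X ⟶ Y) (e : E ⟶ X) (he : e ≫ f = e ≫ g),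
        Nonempty (IsLimit (Fork.ofι e he)) ↔
          Function.Injective e.lin ∧ LinearMap.range e.lin = LinearMap.ker (f.lin - g.lin)) ∧
      (∀ {X Y Q : YD k D} (f g : X ⟶ Y) (q : Y ⟶ Q) (hq : f ≫ q = g ≫ q),
        Nonempty (IsColimit (Cofork.ofπ q hq)) ↔
          Function.Surjective q.lin ∧
            LinearMap.ker q.lin = LinearMap.range (f.lin - g.lin))) ∧
    ∀ (H B A : YD k D) [BraidedHopf H] [MonObj B] [MonObj A],
      ((∃ (act : H ⊗ B ⟶ B) (σ : H ⊗ H ⟶ B), IsWeakAction act ∧ IsTwoCocycle act σ ∧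
          ConvInvertible σ ∧ ∃ e : B ⊗ H ≅ A, IsCrossedProductIso act σ e) ↔
        ∃ (ψ : A ⟶ A ⊗ H) (p : B ⟶ A), IsSplitGaloisWithNormalBasis ψ p) ∧
      ∀ (ψ : A ⟶ A ⊗ H) (p : B ⟶ A),
        (∃ (act : H ⊗ B ⟶ B) (σ : H ⊗ H ⟶ B), IsWeakAction act ∧ IsTwoCocycle act σ ∧
          ConvInvertible σ ∧ ∃ e : B ⊗ H ≅ A, IsCrossedProductIso act σ e ∧
            IsRightColinear ψ e.hom ∧ (ρ_ B).inv ≫ B ◁ η[H] ≫ e.hom = p) ↔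
        IsSplitGaloisWithNormalBasis ψ p := by
  refine ⟨⟨inferInstance, inferInstance, isLimit_iff, isColimit_iff⟩, fun H B A _ _ _ =>
    ⟨⟨?_, ?_⟩, crossedProduct_iff⟩⟩
  · rintro ⟨act, σ, hact, hσ, hconv, e, he⟩
    refine ⟨e.inv ≫ freeCoact B H ≫ e.hom ▷ H, (ρ_ B).inv ≫ B ◁ η[H] ≫ e.hom,
      (crossedProduct_iff _ _).1 ⟨act, σ, hact, hσ, hconv, e, he, ?_, rfl⟩⟩
    exact e.hom_inv_id_assoc _
  · rintro ⟨ψ, p, h⟩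
    obtain ⟨act, σ, hact, hσ, hconv, e, he, -⟩ := (crossedProduct_iff ψ p).2 h
    exact ⟨act, σ, hact, hσ, hconv, e, he⟩
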